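/- Let $M$ be a smooth manifold of dimension $n$ with a smooth Riemannian metric $g$, Levi-Civita connection $\nabla$, Ricci curvature tensor $S$ and scalar curvature $\mathrm{scal}$. Let $\xi$ be a smooth vector field on $M$, let $\eta=g(\xi,\cdot)$ be its $g$-dual $1$-form, and let $\lambda,\mu$ be real constants such that $(g,\xi,\lambda,\mu)$ is an $\eta$-Ricci soliton, that is, $$L_\xi g+2S+2\lambda g+2\mu\,\eta\otimes\eta=0 ,$$ where $L_\xi$ is the Lie derivative along $\xi$. Say that the $g$-dual $1$-form of a vector field $X$ is a solution of the Schrödinger–Ricci equation if $\operatorname{div}(L_Xg)=0$, where the divergence of a symmetric $(0,2)$-tensor field $T$ is the $1$-form $(\operatorname{div}T)(Y)=\sum_{i=1}^n(\nabla_{E_i}T)(E_i,Y)$ for a local orthonormal frame $\{E_i\}$. Then $\eta$ is a solution of the Schrödinger–Ricci equation if and only if $$d(\mathrm{scal})=2\mu\left[(\mathrm{scal}+\lambda n+\mu|\xi|^2)\,\eta-\nabla_\xi\eta\right].$$ Moreover, if $M$ is connected and $\eta$ is a solution of the Schrödinger–Ricci equation, then $\mathrm{scal}$ is constant if and only if $\mu=0$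 or $(\mathrm{scal}+\lambda n+\mu|\xi|^2)\,\eta=\nabla_\xi\eta$ on $M$. If $\mu=0$, then $(g,\xi,\lambda)$ is a Ricci soliton, that is, $L_\xi g+2S+2\lambda g=0$. -/

import Mathlib

open Bundle FiberBundle VectorField
open scoped Manifold ContDiff

set_option linter.unusedSectionVars false

noncomputable section

namespace RiemGeom

variable {E : Type*} [NormedAddCommGroup E] [NormedSpace ℝ E] [FiniteDimensional ℝ E]
  {H : Type*} [TopologicalSpace H] {I : ModelWithCorners ℝ E H}
  {M : Type*} [TopologicalSpace M] [ChartedSpace H M] [IsManifold I ∞ M]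

variable (I M) in
/-- A smooth Riemannian metric on `M`; `g.inner x : T_x M → T_x M → ℝ` is its value at `x`. -/
abbrev Metric := ContMDiffRiemannianMetric I ∞ E (fun x : M ↦ TangentSpace I x)

variable (I M) in
/-- A vector field on `M`. -/
abbrev VField := Π x : M, TangentSpace I x

variable (I M) in
/-- A `1`-form on `M`. -/
abbrev OneForm := Π x : M, TangentSpace I x →L[ℝ] ℝ

variable (I M) in
/-- A `(0,2)`-tensor field on `M`. -/
abbrev Tensor2 := Π x : M, TangentSpace I x →L[ℝ] TangentSpace I x →L[ℝ] ℝ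

/-! ### Orthonormal bases and the musical isomorphisms -/

theorem exists_onb (g : Metric I M) (x : M) :
    ∃ b : Module.Basis (Fin (Module.finrank ℝ E)) ℝ (TangentSpace I x),
      ∀ i j, g.inner x (b i) (b j) = if i = j then 1 else 0 := by
  let _ : NormedAddCommGroup (TangentSpace I x) :=
    (g.toRiemannianMetric.toCore x).toNormedAddCommGroupOfTopology
      (g.toRiemannianMetric.continuousAt x) (g.toRiemannianMetric.isVonNBounded x)
  let _ : InnerProductSpace ℝ (TangentSpace I x) :=
    .ofCoreOfTopology (g.toRiemannianMetric.toCore x)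
      (g.toRiemannianMetric.continuousAt x) (g.toRiemannianMetric.isVonNBounded x)
  have : FiniteDimensional ℝ (TangentSpace I x) := inferInstanceAs (FiniteDimensional ℝ E)
  have hfr : Module.finrank ℝ (TangentSpace I x) = Module.finrank ℝ E := rfl
  let b := (stdOrthonormalBasis ℝ (TangentSpace I x)).reindex (finCongr hfr)
  refine ⟨b.toBasis, fun i j ↦ ?_⟩
  have h := orthonormal_iff_ite.1 b.orthonormal i j
  simpa using! h

/-- A `g`-orthonormal basis of `T_x M`, used to take traces. -/
def onb (g : Metric I M) (x : M) :
    Module.Basis (Fin (Module.finrank ℝ E)) ℝ (TangentSpace I x) :=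
  (exists_onb g x).choose

theorem inner_onb (g : Metric I M) (x : M) (i j : Fin (Module.finrank ℝ E)) :
    g.inner x (onb g x i) (onb g x j) = if i = j then 1 else 0 :=
  (exists_onb g x).choose_spec i j

/-- The `g`-dual `1`-form `X^♭ = g(X, ·)` of a vector field. -/
def flat (g : Metric I M) (X : VField I M) : OneForm I M :=
  fun x ↦ g.inner x (X x)

/-- The vector field `γ^♯` with `g(γ^♯, ·) = γ`. -/
def sharp (g : Metric I M) (γ : OneForm I M) : VField I M :=
  fun x ↦ ∑ i, γ x (onb g x i) • onb g x i

theorem sum_onb_inner (g : Metric I M) (x : M) (A : TangentSpace I x →L[ℝ] ℝ)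
    (v : TangentSpace I x) :
    g.inner x (∑ i, A (onb g x i) • onb g x i) v = A v := by
  have h : (g.inner x (∑ i, A (onb g x i) • onb g x i)).toLinearMap = A.toLinearMap := by
    refine (onb g x).ext fun j ↦ ?_
    simp [inner_onb]
  exact congrArg (fun L ↦ L v) h

theorem flat_sharp (g : Metric I M) (γ : OneForm I M) : flat g (sharp g γ) = γ := by
  funext x
  ext v
  exact sum_onb_inner g x (γ x) v

/-! ### The Levi-Civita connection -/

theorem mdifferentiableAt_inner (g : Metric I M) {X Y : VField I M} {x : M}
    (hX : MDiffAt (T% X) x) (hY : MDiffAt (T% Y) x) :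
    MDiffAt (fun y ↦ g.inner y (X y) (Y y)) x := by
  have : MDifferentiableAt I (I.prod 𝓘(ℝ))
      (fun m ↦ TotalSpace.mk' ℝ (E := Bundle.Trivial M ℝ) m (g.inner m (X m) (Y m))) x := by
    apply MDifferentiableAt.clm_bundle_apply₂ (F₁ := E) (F₂ := E)
    · exact g.contMDiff.contMDiffAt.mdifferentiableAt (by simp)
    · exact hX
    · exact hY
  simp only [mdifferentiableAt_totalSpace] at this
  exact this.2

/-- The right-hand side of the Koszul formula for `g(∇_X Y, Z)`:
`½ (X g(Y,Z) + Y g(X,Z) - Z g(X,Y) + g([X,Y],Z) - g([X,Z],Y) - g([Y,Z],X))`. -/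
def koszul (g : Metric I M) (Y X Z : VField I M) (x : M) : ℝ :=
  (1 / 2 : ℝ) *
    (d% (fun y ↦ g.inner y (Y y) (Z y)) x (X x) + d% (fun y ↦ g.inner y (X y) (Z y)) x (Y x)
        - d% (fun y ↦ g.inner y (X y) (Y y)) x (Z x)
      + g.inner x (mlieBracket I X Y x) (Z x) - g.inner x (mlieBracket I X Z x) (Y x)
        - g.inner x (mlieBracket I Y Z x) (X x))

theorem d_smul_left (g : Metric I M) {f : M → ℝ} {X Z : VField I M} {x : M} (hf : MDiffAt f x)
    (hX : MDiffAt (T% X) x) (hZ : MDiffAt (T% Z) x) :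
    d% (fun y ↦ g.inner y ((f • X) y) (Z y)) x
      = f x • d% (fun y ↦ g.inner y (X y) (Z y)) x + g.inner x (X x) (Z x) • d% f x := by
  rw [← mvfderiv_fun_mul hf (mdifferentiableAt_inner g hX hZ)]
  simp

theorem d_add_left (g : Metric I M) {X X' Z : VField I M} {x : M}
    (hX : MDiffAt (T% X) x) (hX' : MDiffAt (T% X') x) (hZ : MDiffAt (T% Z) x) :
    d% (fun y ↦ g.inner y ((X + X') y) (Z y)) x
      = d% (fun y ↦ g.inner y (X y) (Z y)) x + d% (fun y ↦ g.inner y (X' y) (Z y)) x := by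
  rw [← mvfderiv_fun_add (mdifferentiableAt_inner g hX hZ) (mdifferentiableAt_inner g hX' hZ)]
  simp

theorem d_symm (g : Metric I M) (X Z : VField I M) (x : M) :
    d% (fun y ↦ g.inner y (X y) (Z y)) x = d% (fun y ↦ g.inner y (Z y) (X y)) x := by
  simp only [g.symm _ (X _)]

theorem koszul_tensorial_left (g : Metric I M) {Y Z : VField I M} {x : M}
    (hY : MDiffAt (T% Y) x) (hZ : MDiffAt (T% Z) x) :
    TensorialAt I E (fun X ↦ koszul g Y X Z x) x where
  smul {f X} hf hX := by
    simp only [koszul, d_smul_left g hf hX hZ, d_smul_left g hf hX hY,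
      mlieBracket_smul_left hf hX]
    simp
    ring
  add {X X'} hX hX' := by
    simp only [koszul, d_add_left g hX hX' hZ, d_add_left g hX hX' hY,
      mlieBracket_add_left hX hX']
    simp
    ring

theorem koszul_tensorial_right (g : Metric I M) {Y X : VField I M} {x : M}
    (hY : MDiffAt (T% Y) x) (hX : MDiffAt (T% X) x) :
    TensorialAt I E (fun Z ↦ koszul g Y X Z x) x where
  smul {f Z} hf hZ := by
    simp only [koszul, d_symm g Y, d_symm g X (f • Z), d_symm g X Z, d_smul_left g hf hZ hX,
      d_smul_left g hf hZ hY, mlieBracket_smul_right hf hZ]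
    simp [g.symm x (Z x)]
    ring
  add {Z Z'} hZ hZ' := by
    simp only [koszul, d_symm g Y, d_symm g X (Z + Z'), d_symm g X Z, d_symm g X Z',
      d_add_left g hZ hZ' hX, d_add_left g hZ hZ' hY, mlieBracket_add_right hZ hZ']
    simp
    ring

theorem koszul_sharp_tensorial (g : Metric I M) {Y : VField I M} {x : M}
    (hY : MDiffAt (T% Y) x) :
    TensorialAt I E (fun X : VField I M ↦
      ∑ i, koszul g Y X (extend E (onb g x i)) x • onb g x i) x where
  smul hf hX := by
    rw [Finset.smul_sum]
    refine Finset.sum_congr rfl fun i _ ↦ ?_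
    rw [(koszul_tensorial_left g hY (mdifferentiableAt_extend ..)).smul hf hX, smul_assoc]
  add hX hX' := by
    rw [← Finset.sum_add_distrib]
    refine Finset.sum_congr rfl fun i _ ↦ ?_
    rw [(koszul_tensorial_left g hY (mdifferentiableAt_extend ..)).add hX hX', add_smul]

open scoped Classical in
/-- The Levi-Civita derivative: `nabla g Y x v` is `(∇_v Y)(x)`, given by the Koszul formula
(and `0` where `Y` is not differentiable). -/
def nabla (g : Metric I M) (Y : VField I M) (x : M) : TangentSpace I x →L[ℝ] TangentSpace I x :=
  if hY : MDiffAt (T% Y) x then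
    TensorialAt.mkHom (F := E)
      (fun X : VField I M ↦ ∑ i, koszul g Y X (extend E (onb g x i)) x • onb g x i) x
      (koszul_sharp_tensorial g hY)
  else 0

/-- The Koszul formula, which characterizes `nabla`. -/
theorem inner_nabla (g : Metric I M) {X Y Z : VField I M} {x : M} (hX : MDiffAt (T% X) x)
    (hY : MDiffAt (T% Y) x) (hZ : MDiffAt (T% Z) x) :
    g.inner x (nabla g Y x (X x)) (Z x) = koszul g Y X Z x := by
  rw [nabla, dif_pos hY, TensorialAt.mkHom_apply (koszul_sharp_tensorial g hY) hX]
  have hT := koszul_tensorial_right g hY hX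
  simp only [← TensorialAt.mkHom_apply_eq_extend hT]
  rw [sum_onb_inner, TensorialAt.mkHom_apply hT hZ]

theorem eq_of_inner_eq (g : Metric I M) {x : M} {u v : TangentSpace I x}
    (h : ∀ w, g.inner x u w = g.inner x v w) : u = v := by
  by_contra hne
  have := g.pos x (u - v) (sub_ne_zero.2 hne)
  simp only [map_sub, _root_.sub_apply, h, sub_self, lt_irrefl] at this

theorem nabla_ext (g : Metric I M) {x : M} {A B : TangentSpace I x →L[ℝ] TangentSpace I x}
    (h : ∀ X Z : VField I M, MDiffAt (T% X) x → MDiffAt (T% Z) x →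
      g.inner x (A (X x)) (Z x) = g.inner x (B (X x)) (Z x)) : A = B := by
  ext v
  refine eq_of_inner_eq g fun w ↦ ?_
  have := h (extend E v) (extend E w) (mdifferentiableAt_extend ..) (mdifferentiableAt_extend ..)
  simpa using this

theorem isCovariantDerivativeOn_nabla (g : Metric I M) :
    IsCovariantDerivativeOn E (I := I) (M := M) (V := fun x ↦ TangentSpace I x) (nabla g) where
  add {Y Y' x} hY hY' _ := by
    refine nabla_ext g fun X Z hX hZ ↦ ?_
    have hYY : MDiffAt (T% (Y + Y')) x := mdifferentiableAt_add_section hY hY'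
    rw [_root_.add_apply, map_add, _root_.add_apply,
      inner_nabla g hX hYY hZ, inner_nabla g hX hY hZ, inner_nabla g hX hY' hZ]
    simp only [koszul, d_symm g X (Y + Y'), d_symm g X Y, d_symm g X Y',
      d_add_left g hY hY' hX, d_add_left g hY hY' hZ, mlieBracket_add_right hY hY',
      mlieBracket_add_left hY hY']
    simp
    ring
  leibniz {Y f x} hY hf _ := by
    refine nabla_ext g fun X Z hX hZ ↦ ?_
    have hfY : MDiffAt (T% (f • Y)) x := hf.smul_section hY
    simp only [_root_.add_apply, map_add, _root_.smul_apply, map_smul,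
      inner_nabla g hX hfY hZ, inner_nabla g hX hY hZ, ContinuousLinearMap.smulRight_apply]
    simp only [koszul, d_symm g X (f • Y), d_symm g X Y,
      d_smul_left g hf hY hX, d_smul_left g hf hY hZ, mlieBracket_smul_right hf hY,
      mlieBracket_smul_left hf hY]
    simp
    ring

/-- The Levi-Civita connection of `g`. -/
def leviCivita (g : Metric I M) : CovariantDerivative I E (fun x : M ↦ TangentSpace I x) :=
  ⟨nabla g, isCovariantDerivativeOn_nabla g⟩

/-- The Levi-Civita connection is compatible with the metric. -/
theorem leviCivita_metric (g : Metric I M) {X Y Z : VField I M} {x : M} (hX : MDiffAt (T% X) x)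
    (hY : MDiffAt (T% Y) x) (hZ : MDiffAt (T% Z) x) :
    d% (fun y ↦ g.inner y (Y y) (Z y)) x (X x)
      = g.inner x (leviCivita g Y x (X x)) (Z x) + g.inner x (Y x) (leviCivita g Z x (X x)) := by
  rw [g.symm x (Y x)]
  change _ = g.inner x (nabla g Y x (X x)) (Z x) + g.inner x (nabla g Z x (X x)) (Y x)
  rw [inner_nabla g hX hY hZ, inner_nabla g hX hZ hY]
  simp only [koszul, d_symm g Z Y, mlieBracket_swap_apply (V := Z) (W := Y)]
  simp
  ring

/-- The Levi-Civita connection is torsion-free. -/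
theorem leviCivita_torsion (g : Metric I M) : (leviCivita g).torsion = 0 := by
  rw [CovariantDerivative.torsion_eq_zero_iff]
  intro X Y x hX hY
  refine eq_of_inner_eq g fun w ↦ ?_
  have hw : MDiffAt (T% (extend E w)) x := mdifferentiableAt_extend ..
  have hwx : extend E w x = w := extend_apply_self ..
  rw [← hwx]
  change g.inner x (nabla g Y x (X x) - nabla g X x (Y x)) _ = _
  rw [map_sub, _root_.sub_apply, inner_nabla g hX hY hw, inner_nabla g hY hX hw]
  simp only [koszul, d_symm g Y X, mlieBracket_swap_apply (V := Y) (W := X)]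
  simp
  ring

/-! ### Tensor calculus

Tangent vectors `u` at `x` are extended to vector fields `extend E u`, smooth near `x`, in order to
be differentiated; the values at `x` of the tensorial expressions below do not depend on the
extension. -/

theorem lieMetric_tensorial_left (g : Metric I M) (X : VField I M) {Z : VField I M} {x : M}
    (hZ : MDiffAt (T% Z) x) :
    TensorialAt I E (fun Y : VField I M ↦ d% (fun y ↦ g.inner y (Y y) (Z y)) x (X x)
      - g.inner x (mlieBracket I X Y x) (Z x) - g.inner x (Y x) (mlieBracket I X Z x)) x where
  smul {f Y} hf hY := by
    simp only [d_smul_left g hf hY hZ, mlieBracket_smul_right hf hY]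
    simp
    ring
  add {Y Y'} hY hY' := by
    simp only [d_add_left g hY hY' hZ, mlieBracket_add_right hY hY']
    simp
    ring

theorem lieMetric_tensorial_right (g : Metric I M) (X : VField I M) {Y : VField I M} {x : M}
    (hY : MDiffAt (T% Y) x) :
    TensorialAt I E (fun Z : VField I M ↦ d% (fun y ↦ g.inner y (Y y) (Z y)) x (X x)
      - g.inner x (mlieBracket I X Y x) (Z x) - g.inner x (Y x) (mlieBracket I X Z x)) x where
  smul {f Z} hf hZ := by
    simp only [d_symm g Y, d_smul_left g hf hZ hY, mlieBracket_smul_right hf hZ]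
    simp [g.symm x (Z x)]
    ring
  add {Z Z'} hZ hZ' := by
    simp only [d_symm g Y, d_add_left g hZ hZ' hY, mlieBracket_add_right hZ hZ']
    simp
    ring

/-- The Lie derivative `L_X g`:
`(L_X g)(Y, Z) = X (g(Y, Z)) - g([X, Y], Z) - g(Y, [X, Z])`. -/
def lieMetric (g : Metric I M) (X : VField I M) : Tensor2 I M := fun x ↦
  TensorialAt.mkHom₂ (F := E) (F' := E)
    (fun Y Z : VField I M ↦ d% (fun y ↦ g.inner y (Y y) (Z y)) x (X x)
      - g.inner x (mlieBracket I X Y x) (Z x) - g.inner x (Y x) (mlieBracket I X Z x)) x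
    (fun _ hZ ↦ lieMetric_tensorial_left g X hZ)
    (fun _ hY ↦ lieMetric_tensorial_right g X hY)

/-- `(∇_w γ)(v) = w(γ(V)) - γ(∇_w V)` for a `1`-form `γ`, where `V` extends `v`. -/
def nablaForm (g : Metric I M) (γ : OneForm I M) (x : M) (w v : TangentSpace I x) : ℝ :=
  d% (fun y ↦ γ y (extend E v y)) x w - γ x (leviCivita g (extend E v) x w)

/-- `(∇_w T)(u, v) = w(T(U, V)) - T(∇_w U, v) - T(u, ∇_w V)` for a `(0,2)`-tensor field `T`,
where `U, V` extend `u, v`. -/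
def nablaTensor (g : Metric I M) (T : Tensor2 I M) (x : M) (w u v : TangentSpace I x) : ℝ :=
  d% (fun y ↦ T y (extend E u y) (extend E v y)) x w
    - T x (leviCivita g (extend E u) x w) v - T x u (leviCivita g (extend E v) x w)

/-- The divergence of a `(0,2)`-tensor field, a `1`-form:
`(div T)(v) = ∑ i, (∇_{e_i} T)(e_i, v)` with `e_i` an orthonormal basis. -/
def divTensor (g : Metric I M) (T : Tensor2 I M) (x : M) (v : TangentSpace I x) : ℝ :=
  ∑ i, nablaTensor g T x (onb g x i) (onb g x i) v

/-- The curvature `R(u, v)w = ∇_U ∇_V W - ∇_V ∇_U W - ∇_{[U, V]} W` at `x`,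
where `U, V, W` extend `u, v, w`. -/
def curvature (g : Metric I M) (x : M) (u v w : TangentSpace I x) : TangentSpace I x :=
  let U : VField I M := extend E u
  let V : VField I M := extend E v
  let W : VField I M := extend E w
  leviCivita g (fun y ↦ leviCivita g W y (V y)) x u
    - leviCivita g (fun y ↦ leviCivita g W y (U y)) x v
    - leviCivita g W x (mlieBracket I U V x)

/-- The Ricci curvature `S(v, w) = tr (u ↦ R(u, v)w)`. -/
def ricci (g : Metric I M) (x : M) (v w : TangentSpace I x) : ℝ :=
  ∑ i, g.inner x (curvature g x (onb g x i) v w) (onb g x i)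

/-- The scalar curvature, the trace of the Ricci curvature. -/
def scal (g : Metric I M) (x : M) : ℝ :=
  ∑ i, ricci g x (onb g x i) (onb g x i)

/-! ### Solitons and the Schrödinger–Ricci equation -/

/-- `(g, ξ, lam, mu)`, with the `1`-form `η`, is an `η`-Ricci soliton:
`L_ξ g + 2 S + 2 lam g + 2 mu η ⊗ η = 0`. -/
def IsEtaRicciSoliton (g : Metric I M) (ξ : VField I M) (η : OneForm I M) (lam mu : ℝ) : Prop :=
  ∀ (x : M) (u v : TangentSpace I x),
    lieMetric g ξ x u v + 2 * ricci g x u v + 2 * lam * g.inner x u v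
      + 2 * mu * (η x u * η x v) = 0

/-- `(g, ξ, lam)` is a Ricci soliton: `L_ξ g + 2 S + 2 lam g = 0`. -/
def IsRicciSoliton (g : Metric I M) (ξ : VField I M) (lam : ℝ) : Prop :=
  ∀ (x : M) (u v : TangentSpace I x),
    lieMetric g ξ x u v + 2 * ricci g x u v + 2 * lam * g.inner x u v = 0

/-- The `1`-form `γ`, dual to the vector field `X = γ^♯`, is a solution of the
Schrödinger–Ricci equation: `div (L_X g) = 0`. -/
def IsSchrodingerRicciSolution (g : Metric I M) (γ : OneForm I M) : Prop :=
  ∀ (x : M) (v : TangentSpace I x), divTensor g (lieMetric g (sharp g γ)) x v = 0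

end RiemGeom
end

noncomputable section

namespace RiemGeom

variable {E : Type*} [NormedAddCommGroup E] [NormedSpace ℝ E] [FiniteDimensional ℝ E]
  {H : Type*} [TopologicalSpace H] {I : ModelWithCorners ℝ E H}
  {M : Type*} [TopologicalSpace M] [ChartedSpace H M] [IsManifold I ∞ M]

open Filter Topology

/-! Write the soliton equation as `L_ξ g = -2 S - 2 λ g - 2 μ η ⊗ η` and take its divergence. The
metric is parallel, `2 div S = d scal` by the contracted second Bianchi identity, and `div (η ⊗ η) =
(div ξ) η + ∇_ξ η`. Tracing the soliton equation gives `div ξ = -(scal + λ n + μ |ξ|²)`, whence `div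
(L_ξ g) = -d scal + 2 μ ((scal + λ n + μ |ξ|²) η - ∇_ξ η)`, which is
`IsEtaRicciSoliton.divTensor_lieMetric`. The equivalence is the vanishing of this form; the
constancy criterion follows because, on a connected manifold, `scal` is constant exactly when `d
scal = 0`.

The main work is `contracted_bianchi`. Curvature involves second derivatives, so it is tensorial
only over sufficiently regular fields; `SmoothTensorialAt` records this for smooth ones and makes
curvature independent of the extensions in its definition. Every vector extends to a field parallel
at the given point (`exists_parallel_extension`). For such fields the brackets vanish at the point,
and `second_bianchi` reduces to commuting covariant derivatives.

The bases `onb g x` are chosen point by point, with no continuity in `x`, so a trace cannot be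
differentiated in them. `sum_onb_eq_frame` rewrites traces in a smooth frame with the inverse Gram
matrix. In a frame orthonormal and parallel at `x` this matrix is the identity with zero derivative
at `x`, so traces differentiate termwise there (`ParallelFrame.mvfderiv_trace`). -/

theorem isManifold_infty_add_one : IsManifold I (((⊤ : ℕ∞) : ℕ∞ω) + 1) M :=
  inferInstanceAs (IsManifold I ∞ M)

theorem minSmoothness_le_infty (k : ℕ) : minSmoothness ℝ (k : ℕ∞ω) ≤ ∞ := by
  rw [minSmoothness_of_isRCLikeNormedField]
  exact_mod_cast le_top

theorem isManifold_minSmoothness_two : IsManifold I (minSmoothness ℝ 2) M :=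
  .of_le (minSmoothness_le_infty 2)

theorem isManifold_minSmoothness_three : IsManifold I (minSmoothness ℝ 3) M :=
  .of_le (minSmoothness_le_infty 3)

/-! ### Smoothness of inner products, brackets and directional derivatives -/

theorem mdiffAt_of_smooth {X : VField I M} {x : M} (hX : CMDiffAt ∞ (T% X) x) :
    MDiffAt (T% X) x :=
  hX.mdifferentiableAt (by simp)

/-- Smoothness of order `∞` at `x` gives a neighbourhood of class `C^k` for each finite `k`,
possibly shrinking with `k`. Order one is enough here; where smoothness at all nearby points is
needed, it is assumed explicitly with `∀ᶠ`. -/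
theorem eventually_mdiffAt {X : VField I M} {x : M} (hX : CMDiffAt ∞ (T% X) x) :
    ∀ᶠ y in 𝓝 x, MDiffAt (T% X) y := by
  have h1 : CMDiffAt 1 (T% X) x := hX.of_le (by simp)
  exact ((contMDiffAt_iff_contMDiffAt_nhds (by simp)).1 h1).mono fun y hy ↦ hy.mdifferentiableAt (by simp)

theorem eventually_mdiffAt_fun {f : M → ℝ} {x : M} (hf : CMDiffAt ∞ f x) :
    ∀ᶠ y in 𝓝 x, MDiffAt f y := by
  have h1 : CMDiffAt 1 f x := hf.of_le (by simp)
  exact ((contMDiffAt_iff_contMDiffAt_nhds (by simp)).1 h1).mono fun y hy ↦ hy.mdifferentiableAt (by simp)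

theorem contMDiffAt_inner (g : Metric I M) {X Y : VField I M} {x : M}
    (hX : CMDiffAt ∞ (T% X) x) (hY : CMDiffAt ∞ (T% Y) x) :
    CMDiffAt ∞ (fun y ↦ g.inner y (X y) (Y y)) x := by
  have : ContMDiffAt I (I.prod 𝓘(ℝ)) ∞
      (fun m ↦ TotalSpace.mk' ℝ (E := Bundle.Trivial M ℝ) m (g.inner m (X m) (Y m))) x := by
    apply ContMDiffAt.clm_bundle_apply₂ (F₁ := E) (F₂ := E)
    · exact g.contMDiff.contMDiffAt
    · exact hX
    · exact hY
  simp only [contMDiffAt_totalSpace] at this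
  exact this.2

theorem contMDiffAt_mlieBracket {X Y : VField I M} {x : M}
    (hX : CMDiffAt ∞ (T% X) x) (hY : CMDiffAt ∞ (T% Y) x) :
    CMDiffAt ∞ (T% (mlieBracket I X Y)) x := by
  have : CompleteSpace E := FiniteDimensional.complete ℝ E
  have : IsManifold I (((⊤ : ℕ∞) : ℕ∞ω) + 1) M := isManifold_infty_add_one
  have : IsManifold I (minSmoothness ℝ 2) M := isManifold_minSmoothness_two
  exact ContMDiffAt.mlieBracket_vectorField (m := ⊤) (n := ⊤) hX hY (by simp)

theorem contMDiffAt_smul {f : M → ℝ} {X : VField I M} {x : M}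
    (hf : CMDiffAt ∞ f x) (hX : CMDiffAt ∞ (T% X) x) : CMDiffAt ∞ (T% (f • X)) x :=
  hf.smul_section hX

theorem contMDiffAt_add {X Y : VField I M} {x : M}
    (hX : CMDiffAt ∞ (T% X) x) (hY : CMDiffAt ∞ (T% Y) x) : CMDiffAt ∞ (T% (X + Y)) x :=
  hX.add_section hY

theorem contMDiffAt_sub {X Y : VField I M} {x : M}
    (hX : CMDiffAt ∞ (T% X) x) (hY : CMDiffAt ∞ (T% Y) x) : CMDiffAt ∞ (T% (X - Y)) x :=
  hX.sub_section hY

/-- The derivative of a smooth function along a smooth vector field is smooth: multiply by a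
nonvanishing field `W` and use `[X, f W] = (X f) W + f [X, W]`. -/
theorem contMDiffAt_mvfderiv_apply (g : Metric I M) {f : M → ℝ} {X : VField I M} {x : M}
    (hf : CMDiffAt ∞ f x) (hX : CMDiffAt ∞ (T% X) x) :
    CMDiffAt ∞ (fun y ↦ d% f y (X y)) x := by
  have : CompleteSpace E := FiniteDimensional.complete ℝ E
  have : IsManifold I (minSmoothness ℝ 3) M := isManifold_minSmoothness_three
  -- In dimension zero there is no nonvanishing `W`, but every tangent vector is zero.
  rcases subsingleton_or_nontrivial E with hE | hE
  · have h0 : (fun y ↦ d% f y (X y)) = fun _ ↦ (0 : ℝ) := by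
      funext y
      have : X y = 0 := @Subsingleton.elim E hE _ _
      rw [this, map_zero]
    rw [h0]
    exact contMDiffAt_const
  obtain ⟨w, hw⟩ := exists_ne (0 : E)
  let w' : TangentSpace I x := w
  let W : VField I M := extend E w'
  have hW : CMDiffAt ∞ (T% W) x := contMDiffAt_extend ..
  have hWx : W x = w' := extend_apply_self ..
  have hN : g.inner x (W x) (W x) ≠ 0 := by
    rw [hWx]
    exact (g.pos x w' hw).ne'
  have hfW := contMDiffAt_smul hf hW
  have h1 : CMDiffAt ∞ (fun y ↦ (g.inner y (mlieBracket I X (f • W) y) (W y)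
      - f y * g.inner y (mlieBracket I X W y) (W y)) / g.inner y (W y) (W y)) x :=
    ((contMDiffAt_inner g (contMDiffAt_mlieBracket hX hfW) hW).sub
      (hf.mul (contMDiffAt_inner g (contMDiffAt_mlieBracket hX hW) hW))).div₀
      (contMDiffAt_inner g hW hW) hN
  refine h1.congr_of_eventuallyEq ?_
  have hNe : ∀ᶠ y in 𝓝 x, g.inner y (W y) (W y) ≠ 0 :=
    (contMDiffAt_inner g hW hW).continuousAt.eventually_ne hN
  filter_upwards [eventually_mdiffAt hW, eventually_mdiffAt_fun hf, hNe] with y hWy hfy hNy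
  rw [mlieBracket_smul_right hfy hWy]
  simp
  field_simp

theorem contMDiffAt_minSmoothness_two {X : VField I M} {x : M} (hX : CMDiffAt ∞ (T% X) x) :
    CMDiffAt (minSmoothness ℝ 2) (T% X) x :=
  hX.of_le (minSmoothness_le_infty 2)

/-- The Lie bracket acts on functions as the commutator of derivations. -/
theorem mvfderiv_mlieBracket (g : Metric I M) {f : M → ℝ} {X Y : VField I M} {x : M}
    (hf : CMDiffAt ∞ f x) (hX : CMDiffAt ∞ (T% X) x) (hY : CMDiffAt ∞ (T% Y) x) :
    d% f x (mlieBracket I X Y x)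
      = d% (fun y ↦ d% f y (Y y)) x (X x) - d% (fun y ↦ d% f y (X y)) x (Y x) := by
  have : CompleteSpace E := FiniteDimensional.complete ℝ E
  have : IsManifold I (minSmoothness ℝ 3) M := isManifold_minSmoothness_three
  rcases subsingleton_or_nontrivial E with hE | hE
  · have h0 (v : TangentSpace I x) : v = 0 := @Subsingleton.elim E hE _ _
    rw [h0 (mlieBracket I X Y x), h0 (X x), h0 (Y x)]
    simp
  obtain ⟨w, hw⟩ := exists_ne (0 : E)
  let w' : TangentSpace I x := w
  let W : VField I M := extend E w'
  have hW : CMDiffAt ∞ (T% W) x := contMDiffAt_extend ..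
  have hWx : W x = w' := extend_apply_self ..
  have hfW := contMDiffAt_smul hf hW
  have hfX := contMDiffAt_mvfderiv_apply g hf hX
  have hfY := contMDiffAt_mvfderiv_apply g hf hY
  have hXW := contMDiffAt_mlieBracket hX hW
  have hYW := contMDiffAt_mlieBracket hY hW
  have expand {Z : VField I M} :
      mlieBracket I Z (f • W) =ᶠ[𝓝 x] (fun y ↦ d% f y (Z y)) • W + f • mlieBracket I Z W := by
    filter_upwards [eventually_mdiffAt hW, eventually_mdiffAt_fun hf] with y hWy hfy
    rw [mlieBracket_smul_right hfy hWy]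
    rfl
  have main {Z Z' : VField I M} (hZ : CMDiffAt ∞ (T% Z) x)
      (hfZ : CMDiffAt ∞ (fun y ↦ d% f y (Z y)) x) (hZW : CMDiffAt ∞ (T% (mlieBracket I Z W)) x) :
      mlieBracket I Z' (mlieBracket I Z (f • W)) x
        = d% (fun y ↦ d% f y (Z y)) x (Z' x) • W x + d% f x (Z x) • mlieBracket I Z' W x
          + (d% f x (Z' x) • mlieBracket I Z W x
            + f x • mlieBracket I Z' (mlieBracket I Z W) x) := by
    rw [EventuallyEq.rfl.mlieBracket_vectorField_eq expand,
      mlieBracket_add_right (mdiffAt_of_smooth (contMDiffAt_smul hfZ hW))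
        (mdiffAt_of_smooth (contMDiffAt_smul hf hZW)),
      mlieBracket_smul_right (hfZ.mdifferentiableAt (by simp)) (mdiffAt_of_smooth hW),
      mlieBracket_smul_right (hf.mdifferentiableAt (by simp)) (mdiffAt_of_smooth hZW)]
  -- Compare the Jacobi identity for `X, Y, f W` with `f` times the one for `X, Y, W`. The terms in
  -- `[X, W]` and `[Y, W]` cancel, and the coefficient of the nonzero vector `W x` is the claim.
  have J1 := leibniz_identity_mlieBracket_apply (contMDiffAt_minSmoothness_two hX) (contMDiffAt_minSmoothness_two hY)
    (contMDiffAt_minSmoothness_two hfW)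
  have J2 := leibniz_identity_mlieBracket_apply (contMDiffAt_minSmoothness_two hX) (contMDiffAt_minSmoothness_two hY)
    (contMDiffAt_minSmoothness_two hW)
  rw [main hY hfY hYW, main hX hfX hXW, mlieBracket_smul_right (hf.mdifferentiableAt (by simp))
    (mdiffAt_of_smooth hW), J2] at J1
  have key : (d% f x (mlieBracket I X Y x)) • W x
      = (d% (fun y ↦ d% f y (Y y)) x (X x) - d% (fun y ↦ d% f y (X y)) x (Y x)) • W x := by
    rw [sub_smul]
    rw [← sub_eq_zero] at J1 ⊢
    rw [← neg_eq_zero, ← J1]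
    module
  exact smul_left_injective ℝ (by rw [hWx]; exact hw) key

/-! ### Operations that are tensorial on smooth vector fields -/

variable (I) in
/-- `Φ` is additive and homogeneous over functions, on vector fields that are smooth at `x`. -/
structure SmoothTensorialAt {A : Type*} [AddCommGroup A] [Module ℝ A]
    (Φ : VField I M → A) (x : M) : Prop where
  smul : ∀ {f : M → ℝ} {X : VField I M}, CMDiffAt ∞ f x → CMDiffAt ∞ (T% X) x →
    Φ (f • X) = f x • Φ X
  add : ∀ {X Y : VField I M}, CMDiffAt ∞ (T% X) x → CMDiffAt ∞ (T% Y) x → Φ (X + Y) = Φ X + Φ Y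

namespace SmoothTensorialAt

variable {A : Type*} [AddCommGroup A] [Module ℝ A] {Φ : VField I M → A} {x : M}

/-- The indicator `ψ` of the set where `X = Y` equals `1` near `x`, so it is smooth at `x`, and `ψ •
X = ψ • Y` holds everywhere. No bump function is needed. -/
theorem eq_of_eventuallyEq (hΦ : SmoothTensorialAt I Φ x) {X Y : VField I M}
    (hX : CMDiffAt ∞ (T% X) x) (hY : CMDiffAt ∞ (T% Y) x) (hXY : X =ᶠ[𝓝 x] Y) : Φ X = Φ Y := by
  classical
  let ψ (y : M) : ℝ := if X y = Y y then 1 else 0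
  have hψx : ψ x = 1 := by simp [ψ, hXY.self_of_nhds]
  have h : ψ • X = ψ • Y := by
    funext y
    change ψ y • X y = ψ y • Y y
    dsimp [ψ]
    split_ifs with hy <;> simp [hy]
  have hψ : CMDiffAt ∞ ψ x :=
    (contMDiffAt_const (c := (1 : ℝ))).congr_of_eventuallyEq (hXY.mono fun y hy ↦ by simp [ψ, hy])
  have h1 := hΦ.smul hψ hX
  have h2 := hΦ.smul hψ hY
  rw [hψx, one_smul] at h1 h2
  rw [← h1, ← h2, h]

theorem zero (hΦ : SmoothTensorialAt I Φ x) : Φ 0 = 0 := by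
  have h0 : CMDiffAt ∞ (T% (0 : VField I M)) x := contMDiff_zeroSection ℝ (TangentSpace I) x
  have h := hΦ.smul (f := 0) contMDiffAt_const h0
  simpa using h

theorem sum (hΦ : SmoothTensorialAt I Φ x) {ι : Type*} {s : Finset ι} (X : ι → VField I M)
    (hX : ∀ i, CMDiffAt ∞ (T% (X i)) x) :
    Φ (fun y ↦ ∑ i ∈ s, X i y) = ∑ i ∈ s, Φ (X i) := by
  classical
  induction s using Finset.induction_on with
  | empty => simp only [Finset.sum_empty]; exact hΦ.zero
  | insert a s ha h =>
    simp only [Finset.sum_insert ha, ← h]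
    exact hΦ.add (hX a) (.sum_section fun i _ ↦ hX i)

/-- The value of a tensorial operation depends only on the value of the field at the point. -/
theorem pointwise (hΦ : SmoothTensorialAt I Φ x) {X Y : VField I M}
    (hX : CMDiffAt ∞ (T% X) x) (hY : CMDiffAt ∞ (T% Y) x) (hXY : X x = Y x) : Φ X = Φ Y := by
  let t := trivializationAt E (TangentSpace I) x
  have x_mem : x ∈ t.baseSet := FiberBundle.mem_baseSet_trivializationAt E (TangentSpace I) x
  let b := Module.finBasis ℝ E
  let s := t.localFrame b
  let c := t.localFrameCoeff I b
  have hs (i) : CMDiffAt ∞ (T% (s i)) x := contMDiffAt_localFrame_of_mem ∞ _ b i x_mem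
  have hc {Z : VField I M} (hZ : CMDiffAt ∞ (T% Z) x) (i) :
      CMDiffAt ∞ (LinearMap.piApply (c i) Z) x :=
    contMDiffAt_localFrameCoeff b x_mem hZ i
  have expand {Z : VField I M} (hZ : CMDiffAt ∞ (T% Z) x) :
      Φ Z = ∑ i, c i x (Z x) • Φ (s i) := by
    have hcs (i) := contMDiffAt_smul (hc hZ i) (hs i)
    -- The frame expansion of `Z` holds only near `x`, so locality has to precede additivity.
    rw [hΦ.eq_of_eventuallyEq (Y := fun y ↦ ∑ i, ((LinearMap.piApply (c i) Z) • s i) y) hZ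
      (.sum_section fun i _ ↦ hcs i) (t.eventually_eq_localFrame_sum_coeff_smul b x_mem),
      hΦ.sum _ hcs]
    exact Finset.sum_congr rfl fun i _ ↦ hΦ.smul (hc hZ i) (hs i)
  rw [expand hX, expand hY, hXY]

end SmoothTensorialAt

/-! ### Local frames and their Gram matrices -/

/-- The Gram matrix of a family of vector fields. -/
def gram (g : Metric I M) (F : Fin (Module.finrank ℝ E) → VField I M) (y : M) :
    Matrix (Fin (Module.finrank ℝ E)) (Fin (Module.finrank ℝ E)) ℝ :=
  .of fun i j ↦ g.inner y (F i y) (F j y)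

theorem contMDiffAt_det {ι : Type*} [Fintype ι] [DecidableEq ι] {A : M → Matrix ι ι ℝ} {x : M}
    (hA : ∀ i j, CMDiffAt ∞ (fun y ↦ A y i j) x) : CMDiffAt ∞ (fun y ↦ (A y).det) x := by
  simp only [Matrix.det_apply]
  refine contMDiffAt_finsetSum fun σ _ ↦ ?_
  have h : CMDiffAt ∞ (fun y ↦ ((Equiv.Perm.sign σ : ℤ) : ℝ) * ∏ i, A y (σ i) i) x :=
    contMDiffAt_const.mul (contMDiffAt_finsetProd fun i _ ↦ hA (σ i) i)
  refine h.congr_of_eventuallyEq (.of_forall fun y ↦ ?_)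
  simp [Units.smul_def]

/-- Cramer's rule: each entry of the inverse is a quotient of determinants, with a denominator that
is nonzero at `x`. -/
theorem contMDiffAt_inv_apply {ι : Type*} [Fintype ι] [DecidableEq ι] {A : M → Matrix ι ι ℝ}
    {x : M} (hA : ∀ i j, CMDiffAt ∞ (fun y ↦ A y i j) x) (hx : (A x).det ≠ 0) (i j : ι) :
    CMDiffAt ∞ (fun y ↦ (A y)⁻¹ i j) x := by
  simp only [Matrix.inv_def, Ring.inverse_eq_inv', Matrix.smul_apply, smul_eq_mul,
    Matrix.adjugate_apply]
  refine ((contMDiffAt_det hA).inv₀ hx).mul (contMDiffAt_det fun k l ↦ ?_)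
  simp only [Matrix.updateRow_apply]
  split_ifs
  · exact contMDiffAt_const
  · exact hA k l

section Frame

variable {g : Metric I M} {F : Fin (Module.finrank ℝ E) → VField I M} {x : M}

theorem contMDiffAt_gram (hF : ∀ i, CMDiffAt ∞ (T% (F i)) x) (i j : Fin (Module.finrank ℝ E)) :
    CMDiffAt ∞ (fun y ↦ gram g F y i j) x :=
  contMDiffAt_inner g (hF i) (hF j)

theorem contMDiffAt_gram_inv (hF : ∀ i, CMDiffAt ∞ (T% (F i)) x) (hx : (gram g F x).det ≠ 0)
    (i j : Fin (Module.finrank ℝ E)) : CMDiffAt ∞ (fun y ↦ (gram g F y)⁻¹ i j) x :=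
  contMDiffAt_inv_apply (contMDiffAt_gram hF) hx i j

theorem eventually_gram_det_ne_zero (hF : ∀ i, CMDiffAt ∞ (T% (F i)) x)
    (hx : (gram g F x).det ≠ 0) : ∀ᶠ y in 𝓝 x, (gram g F y).det ≠ 0 :=
  (contMDiffAt_det (contMDiffAt_gram hF)).continuousAt.eventually_ne hx

/-- Pairing a linear relation with each `F j x` puts its coefficients in the left kernel of the Gram
matrix. -/
theorem frame_linearIndependent (hx : (gram g F x).det ≠ 0) :
    LinearIndependent ℝ (fun i ↦ F i x) := by
  rw [Fintype.linearIndependent_iff]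
  intro c hc
  have h : Matrix.vecMul c (gram g F x) = 0 := by
    funext j
    have := congrArg (fun v ↦ g.inner x v (F j x)) hc
    simpa [Matrix.vecMul, dotProduct, gram] using this
  exact congrFun (Matrix.eq_zero_of_vecMul_eq_zero hx h)

theorem eq_of_inner_frame_eq (hx : (gram g F x).det ≠ 0) {u v : TangentSpace I x}
    (h : ∀ k, g.inner x u (F k x) = g.inner x v (F k x)) : u = v := by
  have : FiniteDimensional ℝ (TangentSpace I x) := inferInstanceAs (FiniteDimensional ℝ E)
  have hspan : Submodule.span ℝ (Set.range fun i ↦ F i x) = ⊤ :=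
    (frame_linearIndependent hx).span_eq_top_of_card_eq_finrank' (Fintype.card_fin _)
  have hL : (g.inner x u).toLinearMap = (g.inner x v).toLinearMap :=
    LinearMap.ext_on_range hspan h
  exact eq_of_inner_eq g fun w ↦ congrArg (fun L ↦ L w) hL

/-- Both sides have the same product with every `F k x`, because `G⁻¹ G = 1`. For smooth `F` and a
smooth field in place of `v`, the coefficients vary smoothly with the point. -/
theorem frame_expansion (hx : (gram g F x).det ≠ 0) (v : TangentSpace I x) :
    v = ∑ i, (∑ j, (gram g F x)⁻¹ i j * g.inner x v (F j x)) • F i x := by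
  refine eq_of_inner_frame_eq hx fun k ↦ ?_
  simp only [map_sum, map_smul, _root_.sum_apply, _root_.smul_apply, smul_eq_mul, Finset.sum_mul]
  rw [Finset.sum_comm]
  have hsymm (i j) : (gram g F x)⁻¹ i j = (gram g F x)⁻¹ j i := by
    have hG : (gram g F x).transpose = gram g F x := by
      ext a b
      exact g.symm x _ _
    conv_lhs => rw [← hG, ← Matrix.transpose_nonsing_inv, Matrix.transpose_apply]
  have h1 (j) : ∑ i, (gram g F x)⁻¹ j i * gram g F x i k = if j = k then 1 else 0 := by
    rw [← Matrix.mul_apply, Matrix.nonsing_inv_mul _ (isUnit_iff_ne_zero.2 hx), Matrix.one_apply]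
  have h2 (j) : ∑ i, (gram g F x)⁻¹ i j * g.inner x v (F j x) * g.inner x (F i x) (F k x)
      = g.inner x v (F j x) * if j = k then 1 else 0 := by
    rw [← h1, Finset.mul_sum]
    refine Finset.sum_congr rfl fun i _ ↦ ?_
    rw [hsymm i j]
    simp only [gram, Matrix.of_apply]
    ring
  simp [h2]

/-- The metric trace of a bilinear form, computed in an arbitrary frame. -/
theorem sum_onb_eq_frame (hx : (gram g F x).det ≠ 0)
    (B : TangentSpace I x →ₗ[ℝ] TangentSpace I x →ₗ[ℝ] ℝ) :
    ∑ k, B (onb g x k) (onb g x k)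
      = ∑ i, ∑ j, (gram g F x)⁻¹ i j * B (F i x) (F j x) := by
  have hon (v : TangentSpace I x) : v = ∑ k, g.inner x v (onb g x k) • onb g x k := by
    refine eq_of_inner_eq g fun w ↦ ?_
    rw [sum_onb_inner]
  calc ∑ k, B (onb g x k) (onb g x k)
      = ∑ k, ∑ i, ∑ j, (gram g F x)⁻¹ i j * g.inner x (onb g x k) (F j x)
          * B (F i x) (onb g x k) := by
        refine Finset.sum_congr rfl fun k _ ↦ ?_
        have h := congrArg (fun v ↦ B v (onb g x k)) (frame_expansion (F := F) hx (onb g x k))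
        simpa only [map_sum, map_smul, LinearMap.sum_apply, LinearMap.smul_apply, smul_eq_mul,
          Finset.sum_mul] using h
    _ = ∑ i, ∑ j, (gram g F x)⁻¹ i j * B (F i x) (F j x) := by
        rw [Finset.sum_comm]
        refine Finset.sum_congr rfl fun i _ ↦ ?_
        rw [Finset.sum_comm]
        refine Finset.sum_congr rfl fun j _ ↦ ?_
        -- The first slot was expanded in the frame; expanding `F j x` in the orthonormal basis now
        -- matches the second slot.
        conv_rhs => rw [hon (F j x)]
        simp only [map_sum, map_smul, smul_eq_mul, Finset.mul_sum]
        refine Finset.sum_congr rfl fun k _ ↦ ?_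
        rw [g.symm x (F j x)]
        ring

/-- A vector field is smooth if its inner products with smooth fields are. -/
theorem contMDiffAt_of_inner_frame (hF : ∀ i, CMDiffAt ∞ (T% (F i)) x)
    (hx : (gram g F x).det ≠ 0) {X : VField I M}
    (hX : ∀ j, CMDiffAt ∞ (fun y ↦ g.inner y (X y) (F j y)) x) : CMDiffAt ∞ (T% X) x := by
  have h : CMDiffAt ∞ (T% (fun y ↦ ∑ i, (∑ j, (gram g F y)⁻¹ i j * g.inner y (X y) (F j y))
      • F i y : VField I M)) x :=
    .sum_section fun i _ ↦ .smul_section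
      (contMDiffAt_finsetSum fun j _ ↦ (contMDiffAt_gram_inv hF hx i j).mul (hX j)) (hF i)
  refine h.congr_of_eventuallyEq ?_
  filter_upwards [eventually_gram_det_ne_zero hF hx] with y hy
  rw [← frame_expansion hy (X y)]

end Frame

theorem gram_onb {g : Metric I M} {F : Fin (Module.finrank ℝ E) → VField I M} {x : M}
    (hF : ∀ i, F i x = onb g x i) : gram g F x = 1 := by
  ext i j
  simp [gram, hF, inner_onb, Matrix.one_apply]

/-- A vector field is smooth if its inner products with smooth fields are. -/
theorem contMDiffAt_of_inner (g : Metric I M) {x : M} {X : VField I M}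
    (hX : ∀ Z : VField I M, CMDiffAt ∞ (T% Z) x → CMDiffAt ∞ (fun y ↦ g.inner y (X y) (Z y)) x) :
    CMDiffAt ∞ (T% X) x := by
  let F (i : Fin (Module.finrank ℝ E)) : VField I M := extend E (onb g x i)
  have hF (i) : CMDiffAt ∞ (T% (F i)) x := contMDiffAt_extend ..
  have hx : gram g F x = 1 := gram_onb fun i ↦ extend_apply_self ..
  exact contMDiffAt_of_inner_frame hF (by simp [hx]) fun j ↦ hX _ (hF j)

/-! ### Smoothness of the Levi-Civita derivative -/

theorem contMDiffAt_koszul (g : Metric I M) {X Y Z : VField I M} {x : M}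
    (hY : CMDiffAt ∞ (T% Y) x) (hX : CMDiffAt ∞ (T% X) x) (hZ : CMDiffAt ∞ (T% Z) x) :
    CMDiffAt ∞ (koszul g Y X Z) x := by
  have hd {A B C : VField I M} (hA : CMDiffAt ∞ (T% A) x) (hB : CMDiffAt ∞ (T% B) x)
      (hC : CMDiffAt ∞ (T% C) x) :
      CMDiffAt ∞ (fun y ↦ d% (fun z ↦ g.inner z (A z) (B z)) y (C y)) x :=
    contMDiffAt_mvfderiv_apply g (contMDiffAt_inner g hA hB) hC
  have hb {A B C : VField I M} (hA : CMDiffAt ∞ (T% A) x) (hB : CMDiffAt ∞ (T% B) x)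
      (hC : CMDiffAt ∞ (T% C) x) :
      CMDiffAt ∞ (fun y ↦ g.inner y (mlieBracket I A B y) (C y)) x :=
    contMDiffAt_inner g (contMDiffAt_mlieBracket hA hB) hC
  exact contMDiffAt_const.mul ((((((hd hY hZ hX).add (hd hX hZ hY)).sub (hd hX hY hZ)).add
    (hb hX hY hZ)).sub (hb hX hZ hY)).sub (hb hY hZ hX))

/-- The Levi-Civita derivative of smooth vector fields is smooth. -/
theorem contMDiffAt_leviCivita (g : Metric I M) {X Y : VField I M} {x : M}
    (hY : CMDiffAt ∞ (T% Y) x) (hX : CMDiffAt ∞ (T% X) x) :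
    CMDiffAt ∞ (T% (fun y ↦ leviCivita g Y y (X y) : VField I M)) x := by
  refine contMDiffAt_of_inner g fun Z hZ ↦ ?_
  refine (contMDiffAt_koszul g hY hX hZ).congr_of_eventuallyEq ?_
  filter_upwards [eventually_mdiffAt hX, eventually_mdiffAt hY, eventually_mdiffAt hZ]
    with y hXy hYy hZy
  exact inner_nabla g hXy hYy hZy

/-! ### Covariant derivatives of smooth vector fields -/

/-- The vector field `∇_X Y`. -/
def cov (g : Metric I M) (X Y : VField I M) : VField I M := fun y ↦ leviCivita g Y y (X y)

section Cov

variable {g : Metric I M} {U V W X Y Z : VField I M} {f : M → ℝ} {x : M}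

theorem cov_apply : cov g X Y x = leviCivita g Y x (X x) := rfl

theorem cov_smooth (hX : CMDiffAt ∞ (T% X) x) (hY : CMDiffAt ∞ (T% Y) x) :
    CMDiffAt ∞ (T% (cov g X Y)) x :=
  contMDiffAt_leviCivita g hY hX

theorem cov_add_left : cov g (X + Y) Z = cov g X Z + cov g Y Z := by
  funext y
  exact map_add (leviCivita g Z y) _ _

theorem cov_smul_left : cov g (f • X) Z = f • cov g X Z := by
  funext y
  exact map_smul (leviCivita g Z y) _ _

theorem leviCivita_add (hX : MDiffAt (T% X) x) (hY : MDiffAt (T% Y) x) :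
    leviCivita g (X + Y) x = leviCivita g X x + leviCivita g Y x :=
  (leviCivita g).isCovariantDerivativeOnUniv.add hX hY

theorem leviCivita_smul (hf : MDiffAt f x) (hX : MDiffAt (T% X) x) :
    leviCivita g (f • X) x = f x • leviCivita g X x + (d% f x).smulRight (X x) :=
  (leviCivita g).isCovariantDerivativeOnUniv.leibniz hX hf

theorem leviCivita_congr (hX : CMDiffAt ∞ (T% X) x) (hXY : X =ᶠ[𝓝 x] Y) :
    leviCivita g X x = leviCivita g Y x := by
  have hY : CMDiffAt ∞ (T% Y) x := hX.congr_of_eventuallyEq (hXY.mono fun y hy ↦ by simp [hy])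
  exact (leviCivita g).isCovariantDerivativeOnUniv.congr_of_eventuallyEq (mdiffAt_of_smooth hX)
    (mdiffAt_of_smooth hY) Filter.univ_mem hXY

theorem leviCivita_sub (hX : CMDiffAt ∞ (T% X) x) (hY : CMDiffAt ∞ (T% Y) x) :
    leviCivita g (X - Y) x = leviCivita g X x - leviCivita g Y x := by
  have h := leviCivita_add (g := g) (mdiffAt_of_smooth (contMDiffAt_sub hX hY))
    (mdiffAt_of_smooth hY)
  rw [sub_add_cancel] at h
  rw [h, add_sub_cancel_right]

theorem cov_add_right (hX : MDiffAt (T% X) x) (hY : MDiffAt (T% Y) x) :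
    cov g Z (X + Y) x = cov g Z X x + cov g Z Y x := by
  simp only [cov, leviCivita_add hX hY, _root_.add_apply]

theorem cov_smul_right (hf : MDiffAt f x) (hX : MDiffAt (T% X) x) :
    cov g Z (f • X) x = f x • cov g Z X x + d% f x (Z x) • X x := by
  simp only [cov, leviCivita_smul hf hX, _root_.add_apply, _root_.smul_apply,
    ContinuousLinearMap.smulRight_apply]

theorem mlieBracket_eq_cov (hX : MDiffAt (T% X) x) (hY : MDiffAt (T% Y) x) :
    mlieBracket I X Y x = cov g X Y x - cov g Y X x :=
  (((leviCivita g).torsion_eq_zero_iff.1 (leviCivita_torsion g)) hX hY).symm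

/-! ### The curvature of smooth vector fields -/

/-- The curvature `R(U, V)W` as a vector field. -/
def fieldCurvature (g : Metric I M) (U V W : VField I M) : VField I M :=
  cov g U (cov g V W) - cov g V (cov g U W) - cov g (mlieBracket I U V) W

theorem fieldCurvature_apply : fieldCurvature g U V W x
    = cov g U (cov g V W) x - cov g V (cov g U W) x - cov g (mlieBracket I U V) W x := rfl

theorem fieldCurvature_smooth (hU : CMDiffAt ∞ (T% U) x) (hV : CMDiffAt ∞ (T% V) x)
    (hW : CMDiffAt ∞ (T% W) x) : CMDiffAt ∞ (T% (fieldCurvature g U V W)) x :=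
  contMDiffAt_sub (contMDiffAt_sub (cov_smooth hU (cov_smooth hV hW))
    (cov_smooth hV (cov_smooth hU hW))) (cov_smooth (contMDiffAt_mlieBracket hU hV) hW)

theorem fieldCurvature_swap : fieldCurvature g U V W x = -fieldCurvature g V U W x := by
  have h : cov g (mlieBracket I U V) W x = -cov g (mlieBracket I V U) W x := by
    rw [cov_apply, mlieBracket_swap_apply, map_neg, cov_apply]
  rw [fieldCurvature_apply, fieldCurvature_apply, h]
  module

/-- The term `(V f) ∇_U W` produced by `∇_V (f ∇_U W)` cancels the one coming from `[f U, V] = f [U,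
V] - (V f) U`. -/
theorem fieldCurvature_tensorial_left (hW : CMDiffAt ∞ (T% W) x) :
    SmoothTensorialAt I (fun U ↦ fieldCurvature g U V W x) x where
  smul {f U} hf hU := by
    have : CompleteSpace E := FiniteDimensional.complete ℝ E
    simp only [fieldCurvature_apply]
    rw [cov_smul_left, cov_smul_left, cov_smul_right (hf.mdifferentiableAt (by simp))
      (mdiffAt_of_smooth (cov_smooth hU hW)), cov_apply (X := mlieBracket I (f • U) V),
      mlieBracket_smul_left (hf.mdifferentiableAt (by simp)) (mdiffAt_of_smooth hU), map_add,
      map_smul, map_smul]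
    simp only [Pi.smul_apply', cov_apply (X := mlieBracket I U V), cov_apply (X := U) (Y := W)]
    module
  add {U U'} hU hU' := by
    have : CompleteSpace E := FiniteDimensional.complete ℝ E
    simp only [fieldCurvature_apply]
    rw [cov_add_left, cov_add_left, cov_add_right (mdiffAt_of_smooth (cov_smooth hU hW))
      (mdiffAt_of_smooth (cov_smooth hU' hW)), cov_apply (X := mlieBracket I (U + U') V),
      mlieBracket_add_left (mdiffAt_of_smooth hU) (mdiffAt_of_smooth hU'), map_add]
    simp only [Pi.add_apply, cov_apply (X := mlieBracket I _ V)]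
    module

theorem fieldCurvature_tensorial_middle (hW : CMDiffAt ∞ (T% W) x) :
    SmoothTensorialAt I (fun V ↦ fieldCurvature g U V W x) x where
  smul {f V} hf hV := by
    simp only [fieldCurvature_swap (U := U)]
    rw [(fieldCurvature_tensorial_left hW).smul hf hV, smul_neg]
  add {V V'} hV hV' := by
    simp only [fieldCurvature_swap (U := U)]
    rw [(fieldCurvature_tensorial_left hW).add hV hV', neg_add]

theorem cov_cov_smul (hV : CMDiffAt ∞ (T% V) x)
    (hW : CMDiffAt ∞ (T% W) x) (hf : CMDiffAt ∞ f x) :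
    cov g U (cov g V (f • W)) x
      = f x • cov g U (cov g V W) x + d% f x (U x) • cov g V W x + (d% f x (V x) • cov g U W x
        + d% (fun y ↦ d% f y (V y)) x (U x) • W x) := by
  have hfV := contMDiffAt_mvfderiv_apply g hf hV
  have h : cov g V (f • W) =ᶠ[𝓝 x] f • cov g V W + (fun y ↦ d% f y (V y)) • W := by
    filter_upwards [eventually_mdiffAt hW, eventually_mdiffAt_fun hf] with y hWy hfy
    exact cov_smul_right hfy hWy
  rw [cov_apply, leviCivita_congr (cov_smooth hV (contMDiffAt_smul hf hW)) h, ← cov_apply (g := g),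
    cov_add_right (mdiffAt_of_smooth (contMDiffAt_smul hf (cov_smooth hV hW)))
      (mdiffAt_of_smooth (contMDiffAt_smul hfV hW)),
    cov_smul_right (hf.mdifferentiableAt (by simp)) (mdiffAt_of_smooth (cov_smooth hV hW)),
    cov_smul_right (hfV.mdifferentiableAt (by simp)) (mdiffAt_of_smooth hW)]

theorem cov_cov_add (hV : CMDiffAt ∞ (T% V) x)
    (hW : CMDiffAt ∞ (T% W) x) (hZ : CMDiffAt ∞ (T% Z) x) :
    cov g U (cov g V (W + Z)) x = cov g U (cov g V W) x + cov g U (cov g V Z) x := by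
  have h : cov g V (W + Z) =ᶠ[𝓝 x] cov g V W + cov g V Z := by
    filter_upwards [eventually_mdiffAt hW, eventually_mdiffAt hZ] with y hWy hZy
    exact cov_add_right hWy hZy
  rw [cov_apply, leviCivita_congr (cov_smooth hV (contMDiffAt_add hW hZ)) h, ← cov_apply (g := g),
    cov_add_right (mdiffAt_of_smooth (cov_smooth hV hW)) (mdiffAt_of_smooth (cov_smooth hV hZ))]

/-- The first-order terms in `f` are symmetric in `U, V` and cancel; what remains is `(U V f - V U f
- [U, V] f) W`, which is zero by `mvfderiv_mlieBracket`. -/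
theorem fieldCurvature_tensorial_right (hU : CMDiffAt ∞ (T% U) x) (hV : CMDiffAt ∞ (T% V) x) :
    SmoothTensorialAt I (fun W ↦ fieldCurvature g U V W x) x where
  smul {f W} hf hW := by
    simp only [fieldCurvature_apply]
    rw [cov_cov_smul hV hW hf, cov_cov_smul hU hW hf,
      cov_smul_right (hf.mdifferentiableAt (by simp)) (mdiffAt_of_smooth hW),
      mvfderiv_mlieBracket g hf hU hV]
    module
  add {W W'} hW hW' := by
    simp only [fieldCurvature_apply]
    rw [cov_cov_add hV hW hW', cov_cov_add hU hW hW',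
      cov_add_right (mdiffAt_of_smooth hW) (mdiffAt_of_smooth hW')]
    module

theorem fieldCurvature_pointwise {U' V' W' : VField I M} (hU : CMDiffAt ∞ (T% U) x)
    (hV : CMDiffAt ∞ (T% V) x) (hW : CMDiffAt ∞ (T% W) x) (hU' : CMDiffAt ∞ (T% U') x)
    (hV' : CMDiffAt ∞ (T% V') x) (hW' : CMDiffAt ∞ (T% W') x) (hUU : U x = U' x)
    (hVV : V x = V' x) (hWW : W x = W' x) :
    fieldCurvature g U V W x = fieldCurvature g U' V' W' x := by
  rw [(fieldCurvature_tensorial_left hW).pointwise hU hU' hUU,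
    (fieldCurvature_tensorial_middle hW).pointwise hV hV' hVV,
    (fieldCurvature_tensorial_right hU' hV').pointwise hW hW' hWW]

/-- `curvature` is the value of the curvature of any smooth extensions. -/
theorem curvature_eq (hU : CMDiffAt ∞ (T% U) x) (hV : CMDiffAt ∞ (T% V) x)
    (hW : CMDiffAt ∞ (T% W) x) : curvature g x (U x) (V x) (W x) = fieldCurvature g U V W x := by
  rw [← fieldCurvature_pointwise (contMDiffAt_extend ..) (contMDiffAt_extend ..)
    (contMDiffAt_extend ..) hU hV hW (extend_apply_self ..) (extend_apply_self ..)
    (extend_apply_self ..)]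
  simp only [fieldCurvature_apply, cov_apply, extend_apply_self]
  rfl

/-! ### Skew-adjointness of the curvature operator -/

theorem mvfderiv_inner_eventuallyEq (hX : CMDiffAt ∞ (T% X) x) (hW : CMDiffAt ∞ (T% W) x)
    (hZ : CMDiffAt ∞ (T% Z) x) :
    (fun y ↦ d% (fun z ↦ g.inner z (W z) (Z z)) y (X y)) =ᶠ[𝓝 x]
      fun y ↦ g.inner y (cov g X W y) (Z y) + g.inner y (W y) (cov g X Z y) := by
  filter_upwards [eventually_mdiffAt hX, eventually_mdiffAt hW, eventually_mdiffAt hZ]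
    with y hXy hWy hZy
  exact leviCivita_metric g hXy hWy hZy

theorem mvfderiv_congr {f f' : M → ℝ} (h : f =ᶠ[𝓝 x] f') : d% f x = d% f' x := by
  have := h.mfderiv_eq (I := I) (I' := 𝓘(ℝ))
  simp only [mvfderiv, this]
  ext v
  simp
  rfl

theorem mvfderiv_mvfderiv_inner (hX : CMDiffAt ∞ (T% X) x) (hY : CMDiffAt ∞ (T% Y) x)
    (hW : CMDiffAt ∞ (T% W) x) (hZ : CMDiffAt ∞ (T% Z) x) :
    d% (fun y ↦ d% (fun z ↦ g.inner z (W z) (Z z)) y (Y y)) x (X x)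
      = g.inner x (cov g X (cov g Y W) x) (Z x) + g.inner x (cov g Y W x) (cov g X Z x)
        + (g.inner x (cov g X W x) (cov g Y Z x) + g.inner x (W x) (cov g X (cov g Y Z) x)) := by
  have hYW := cov_smooth (g := g) hY hW
  have hYZ := cov_smooth (g := g) hY hZ
  rw [mvfderiv_congr (mvfderiv_inner_eventuallyEq hY hW hZ), mvfderiv_fun_add
    (mdifferentiableAt_inner g (mdiffAt_of_smooth hYW) (mdiffAt_of_smooth hZ))
    (mdifferentiableAt_inner g (mdiffAt_of_smooth hW) (mdiffAt_of_smooth hYZ)),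
    _root_.add_apply,
    leviCivita_metric g (mdiffAt_of_smooth hX) (mdiffAt_of_smooth hYW) (mdiffAt_of_smooth hZ),
    leviCivita_metric g (mdiffAt_of_smooth hX) (mdiffAt_of_smooth hW) (mdiffAt_of_smooth hYZ)]
  rfl

/-- The curvature operator is skew-adjoint. -/
theorem inner_fieldCurvature_skew (hU : CMDiffAt ∞ (T% U) x) (hV : CMDiffAt ∞ (T% V) x)
    (hW : CMDiffAt ∞ (T% W) x) (hZ : CMDiffAt ∞ (T% Z) x) :
    g.inner x (fieldCurvature g U V W x) (Z x) = -g.inner x (fieldCurvature g U V Z x) (W x) := by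
  -- Expand `[U, V] = U V - V U` on the function `g(W, Z)` by metric compatibility; the mixed
  -- products of first derivatives cancel.
  have h := mvfderiv_mlieBracket g (contMDiffAt_inner g hW hZ) hU hV
  rw [mvfderiv_mvfderiv_inner hU hV hW hZ, mvfderiv_mvfderiv_inner hV hU hW hZ,
    leviCivita_metric g (mdiffAt_of_smooth (contMDiffAt_mlieBracket hU hV)) (mdiffAt_of_smooth hW)
      (mdiffAt_of_smooth hZ), ← cov_apply, ← cov_apply] at h
  simp only [fieldCurvature_apply, map_sub, _root_.sub_apply, g.symm x _ (W x)]
  rw [g.symm x (cov g V W x)] at h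
  linarith

/-- A vector field that vanishes at a point may be replaced by zero in the curvature. -/
theorem fieldCurvature_eq_zero_of_right (hU : CMDiffAt ∞ (T% U) x) (hV : CMDiffAt ∞ (T% V) x)
    (hW : CMDiffAt ∞ (T% W) x) (h : W x = 0) : fieldCurvature g U V W x = 0 := by
  have hT := fieldCurvature_tensorial_right (g := g) hU hV
  rw [hT.pointwise hW (contMDiff_zeroSection ℝ (TangentSpace I) x) h]
  exact hT.zero

theorem fieldCurvature_eq_zero_of_middle (hV : CMDiffAt ∞ (T% V) x) (hW : CMDiffAt ∞ (T% W) x)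
    (h : V x = 0) : fieldCurvature g U V W x = 0 := by
  have hT := fieldCurvature_tensorial_middle (g := g) (U := U) hW
  rw [hT.pointwise hV (contMDiff_zeroSection ℝ (TangentSpace I) x) h]
  exact hT.zero

/-! ### The second Bianchi identity -/

theorem mlieBracket_eq_zero_of_leviCivita_eq_zero (hX : MDiffAt (T% X) x) (hY : MDiffAt (T% Y) x)
    (hX0 : leviCivita g X x = 0) (hY0 : leviCivita g Y x = 0) : mlieBracket I X Y x = 0 := by
  rw [mlieBracket_eq_cov (g := g) hX hY, cov_apply, cov_apply, hX0, hY0]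
  simp

/-- The term `∇_U ∇_{[V, W]} Z` drops out although `[V, W]` vanishes only at `x`: there `R(U, [V,
W]) Z = 0`, which trades it for `∇_{[V, W]} ∇_U Z + ∇_{[U, [V, W]]} Z`. The first summand is zero
since `[V, W]` vanishes at `x`, the second since `Z` is parallel there. -/
theorem cov_fieldCurvature (hV : CMDiffAt ∞ (T% V) x) (hW : CMDiffAt ∞ (T% W) x)
    (hZ : CMDiffAt ∞ (T% Z) x) (hZ0 : leviCivita g Z x = 0)
    (hVW : mlieBracket I V W x = 0) :
    cov g U (fieldCurvature g V W Z) x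
      = cov g U (cov g V (cov g W Z)) x - cov g U (cov g W (cov g V Z)) x := by
  have hb := contMDiffAt_mlieBracket hV hW
  have h1 := cov_smooth (g := g) hV (cov_smooth (g := g) hW hZ)
  have h2 := cov_smooth (g := g) hW (cov_smooth (g := g) hV hZ)
  have h3 := fieldCurvature_eq_zero_of_middle (g := g) (U := U) hb hZ hVW
  have h4 : cov g U (cov g (mlieBracket I V W) Z) x = 0 := by
    rw [fieldCurvature_apply, cov_apply (X := mlieBracket I V W), hVW, map_zero,
      cov_apply (X := mlieBracket I U _), hZ0] at h3
    simpa using h3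
  rw [cov_apply, fieldCurvature, leviCivita_sub (contMDiffAt_sub h1 h2) (cov_smooth hb hZ),
    leviCivita_sub h1 h2, _root_.sub_apply, _root_.sub_apply, ← cov_apply, ← cov_apply,
    ← cov_apply, h4, sub_zero]

/-- The second Bianchi identity, at a point where the fields are parallel. -/
theorem second_bianchi (hU : CMDiffAt ∞ (T% U) x) (hV : CMDiffAt ∞ (T% V) x)
    (hW : CMDiffAt ∞ (T% W) x) (hZ : CMDiffAt ∞ (T% Z) x) (hU0 : leviCivita g U x = 0)
    (hV0 : leviCivita g V x = 0) (hW0 : leviCivita g W x = 0) (hZ0 : leviCivita g Z x = 0) :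
    cov g U (fieldCurvature g V W Z) x + cov g V (fieldCurvature g W U Z) x
      + cov g W (fieldCurvature g U V Z) x = 0 := by
  have hb {X Y : VField I M} (hX : CMDiffAt ∞ (T% X) x) (hY : CMDiffAt ∞ (T% Y) x)
      (hX0 : leviCivita g X x = 0) (hY0 : leviCivita g Y x = 0) : mlieBracket I X Y x = 0 :=
    mlieBracket_eq_zero_of_leviCivita_eq_zero (mdiffAt_of_smooth hX) (mdiffAt_of_smooth hY) hX0 hY0
  -- The field `∇_C Z` vanishes at `x`, hence so does `R(A, B) ∇_C Z`, and the two outer derivatives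
  -- commute. The six third derivatives then cancel in pairs.
  have hcomm {A B C : VField I M} (hA : CMDiffAt ∞ (T% A) x) (hB : CMDiffAt ∞ (T% B) x)
      (hC : CMDiffAt ∞ (T% C) x) (hAB : mlieBracket I A B x = 0) :
      cov g A (cov g B (cov g C Z)) x = cov g B (cov g A (cov g C Z)) x := by
    have h := fieldCurvature_eq_zero_of_right (g := g) hA hB (cov_smooth hC hZ)
      (by rw [cov_apply, hZ0]; rfl)
    rw [fieldCurvature_apply, cov_apply (X := mlieBracket I A B), hAB, map_zero, sub_zero] at h
    exact sub_eq_zero.1 h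
  rw [cov_fieldCurvature hV hW hZ hZ0 (hb hV hW hV0 hW0),
    cov_fieldCurvature hW hU hZ hZ0 (hb hW hU hW0 hU0),
    cov_fieldCurvature hU hV hZ hZ0 (hb hU hV hU0 hV0),
    hcomm hU hV hW (hb hU hV hU0 hV0), hcomm hV hW hU (hb hV hW hV0 hW0),
    hcomm hW hU hV (hb hW hU hW0 hU0)]
  module

end Cov

/-! ### Frames that are parallel at a point -/

section Parallel

variable {g : Metric I M} {x : M}

theorem leviCivita_sum {ι : Type*} {s : Finset ι} {X : ι → VField I M}
    (hX : ∀ i, MDiffAt (T% (X i)) x) :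
    leviCivita g (fun y ↦ ∑ i ∈ s, X i y) x = ∑ i ∈ s, leviCivita g (X i) x := by
  classical
  induction s using Finset.induction_on with
  | empty =>
    simp only [Finset.sum_empty]
    exact (leviCivita g).isCovariantDerivativeOnUniv.zero
  | insert a s ha h =>
    simp only [Finset.sum_insert ha, ← h]
    exact leviCivita_add (hX a) (.sum_section fun i _ ↦ hX i)

theorem eventually_smooth_extend (v : TangentSpace I x) :
    ∀ᶠ y in 𝓝 x, CMDiffAt ∞ (T% (extend E v : VField I M)) y := by
  obtain ⟨s, hs, hsv⟩ := exists_contMDiffOn_extend (k := ∞) I E v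
  filter_upwards [eventually_mem_nhds_iff.2 hs] with y hy
  exact hsv.contMDiffAt hy

/-- A function, smooth near `x`, that vanishes at `x` and has a prescribed differential there. -/
theorem exists_function_mvfderiv_eq (L : TangentSpace I x →L[ℝ] ℝ) :
    ∃ f : M → ℝ, (∀ᶠ y in 𝓝 x, CMDiffAt ∞ f y) ∧ f x = 0 ∧ d% f x = L := by
  let L' : E →L[ℝ] ℝ := L
  have hL : ContDiff ℝ ∞ (fun z : E ↦ L' (z - extChartAt I x x)) :=
    L'.contDiff.comp (contDiff_id.sub contDiff_const)
  have hL' (z : E) : HasFDerivAt (fun z : E ↦ L' (z - extChartAt I x x)) L' z :=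
    L'.hasFDerivAt.comp z ((hasFDerivAt_id z).sub_const _)
  -- A linear functional read in the chart at `x`, whose differential at `x` is the identity.
  refine ⟨(fun z : E ↦ L' (z - extChartAt I x x)) ∘ extChartAt I x, ?_, by simp, ?_⟩
  · filter_upwards [chart_source_mem_nhds H x] with y hy
    exact hL.contMDiff.contMDiffAt.comp y (contMDiffAt_extChartAt' hy)
  · have h : mvfderiv 𝓘(ℝ, E) (fun z : E ↦ L' (z - extChartAt I x x)) (extChartAt I x x) = L' := by
      simp only [mvfderiv, mfderiv_eq_fderiv, (hL' _).fderiv]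
      rfl
    rw [mvfderiv_comp x ((hL' _).differentiableAt.mdifferentiableAt)
      (mdifferentiableAt_extChartAt (mem_chart_source H x)), mfderiv_extChartAt_self, h]
    rfl

theorem onb_expansion (g : Metric I M) (v : TangentSpace I x) :
    ∑ k, g.inner x v (onb g x k) • onb g x k = v :=
  eq_of_inner_eq g fun w ↦ sum_onb_inner g x (g.inner x v) w

variable (g) in
-- Correct any extension `s` by `∑ f_j e_j` with `f_j x = 0` and `d f_j = g(e_j, ∇ s)` at `x`. The
-- value at `x` is unchanged, and by the Leibniz rule the correction has derivative `∑ d f_j ⊗ e_j =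
-- ∇ s` there.
theorem exists_parallel_extension (v : TangentSpace I x) :
    ∃ V : VField I M, (∀ᶠ y in 𝓝 x, CMDiffAt ∞ (T% V) y) ∧ V x = v ∧ leviCivita g V x = 0 := by
  let s : VField I M := extend E v
  let e (j : Fin (Module.finrank ℝ E)) : VField I M := extend E (onb g x j)
  have hs : ∀ᶠ y in 𝓝 x, CMDiffAt ∞ (T% s) y := eventually_smooth_extend v
  have he (j) : ∀ᶠ y in 𝓝 x, CMDiffAt ∞ (T% (e j)) y := eventually_smooth_extend (onb g x j)
  have hex (j) : e j x = onb g x j := extend_apply_self ..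
  choose f hf hfx hdf using fun j ↦
    exists_function_mvfderiv_eq ((g.inner x (onb g x j)).comp (leviCivita g s x))
  have hfe (j) : ∀ᶠ y in 𝓝 x, CMDiffAt ∞ (T% (f j • e j)) y := by
    filter_upwards [hf j, he j] with y h1 h2
    exact contMDiffAt_smul h1 h2
  let c : VField I M := fun y ↦ ∑ j, (f j • e j) y
  have hc : ∀ᶠ y in 𝓝 x, CMDiffAt ∞ (T% c) y := by
    filter_upwards [eventually_all.2 hfe] with y hy
    exact .sum_section fun j _ ↦ hy j
  refine ⟨s - c, ?_, ?_, ?_⟩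
  · filter_upwards [hs, hc] with y h1 h2
    exact contMDiffAt_sub h1 h2
  · simp [c, s, hfx]
  · rw [leviCivita_sub hs.self_of_nhds hc.self_of_nhds,
      leviCivita_sum fun j ↦ mdiffAt_of_smooth (hfe j).self_of_nhds]
    have hterm (j) : leviCivita g (f j • e j) x
        = ((g.inner x (onb g x j)).comp (leviCivita g s x)).smulRight (onb g x j) := by
      rw [leviCivita_smul ((hf j).self_of_nhds.mdifferentiableAt (by simp))
        (mdiffAt_of_smooth (he j).self_of_nhds), hfx, hdf, hex, zero_smul, zero_add]
    simp only [hterm]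
    ext w
    have h := onb_expansion g (leviCivita g s x w)
    simp only [g.symm x (leviCivita g s x w)] at h
    simp [h]

variable (g x) in
/-- A frame near `x`, orthonormal and parallel at `x`. -/
structure ParallelFrame where
  field : Fin (Module.finrank ℝ E) → VField I M
  smooth : ∀ i, ∀ᶠ y in 𝓝 x, CMDiffAt ∞ (T% (field i)) y
  apply : ∀ i, field i x = onb g x i
  parallel : ∀ i, leviCivita g (field i) x = 0

variable (g x) in
theorem nonempty_parallelFrame : Nonempty (ParallelFrame g x) := by
  choose F h1 h2 h3 using fun i ↦ exists_parallel_extension g (onb g x i)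
  exact ⟨⟨F, h1, h2, h3⟩⟩

theorem mvfderiv_inner_eq_zero {V W : VField I M} (hV : CMDiffAt ∞ (T% V) x)
    (hW : CMDiffAt ∞ (T% W) x) (hV0 : leviCivita g V x = 0) (hW0 : leviCivita g W x = 0) :
    d% (fun y ↦ g.inner y (V y) (W y)) x = 0 := by
  ext w
  have h := leviCivita_metric g (X := extend E w) (mdiffAt_of_smooth (contMDiffAt_extend ..))
    (mdiffAt_of_smooth hV) (mdiffAt_of_smooth hW)
  rw [hV0, hW0, extend_apply_self] at h
  simpa using h

theorem mvfderiv_sum {ι : Type*} {s : Finset ι} {f : ι → M → ℝ}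
    (hf : ∀ i, CMDiffAt ∞ (f i) x) :
    d% (fun y ↦ ∑ i ∈ s, f i y) x = ∑ i ∈ s, d% (f i) x := by
  classical
  induction s using Finset.induction_on with
  | empty =>
    simp only [Finset.sum_empty]
    exact mvfderiv_const _
  | insert a s ha h =>
    simp only [Finset.sum_insert ha, ← h]
    exact mvfderiv_fun_add ((hf a).mdifferentiableAt (by simp))
      ((contMDiffAt_finsetSum fun i _ ↦ hf i).mdifferentiableAt (by simp))

namespace ParallelFrame

variable (F : ParallelFrame g x)

theorem smoothAt (i : Fin (Module.finrank ℝ E)) : CMDiffAt ∞ (T% (F.field i)) x :=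
  (F.smooth i).self_of_nhds

theorem gram_eq_one : gram g F.field x = 1 := gram_onb F.apply

theorem gram_det_ne_zero : (gram g F.field x).det ≠ 0 := by simp [F.gram_eq_one]

/-- Differentiate `G⁻¹ G = 1` at `x`, where `G = 1` and, by metric compatibility, `d G = 0`. -/
theorem mvfderiv_gram_inv (i j : Fin (Module.finrank ℝ E)) :
    d% (fun y ↦ (gram g F.field y)⁻¹ i j) x = 0 := by
  have hG := contMDiffAt_gram (g := g) F.smoothAt
  have hGi := contMDiffAt_gram_inv F.smoothAt F.gram_det_ne_zero
  have h : (fun y ↦ ∑ k, (gram g F.field y)⁻¹ i k * gram g F.field y k j)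
      =ᶠ[𝓝 x] fun _ ↦ (1 : Matrix _ _ ℝ) i j := by
    filter_upwards [eventually_gram_det_ne_zero F.smoothAt F.gram_det_ne_zero] with y hy
    rw [← Matrix.mul_apply, Matrix.nonsing_inv_mul _ (isUnit_iff_ne_zero.2 hy)]
  have hm (k) : CMDiffAt ∞ (fun y ↦ (gram g F.field y)⁻¹ i k * gram g F.field y k j) x :=
    (hGi i k).mul (hG k j)
  have hd := mvfderiv_congr (I := I) h
  rw [mvfderiv_sum hm, mvfderiv_const] at hd
  have hterm (k) : d% (fun y ↦ (gram g F.field y)⁻¹ i k * gram g F.field y k j) x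
      = (if k = j then 1 else 0 : ℝ) • d% (fun y ↦ (gram g F.field y)⁻¹ i k) x := by
    have h0 : d% (fun y ↦ gram g F.field y k j) x = 0 :=
      mvfderiv_inner_eq_zero (F.smoothAt k) (F.smoothAt j) (F.parallel k) (F.parallel j)
    rw [mvfderiv_fun_mul ((hGi i k).mdifferentiableAt (by simp))
      ((hG k j).mdifferentiableAt (by simp)), h0, F.gram_eq_one, Matrix.one_apply, smul_zero,
      zero_add]
  simpa [hterm] using hd

/-- At the centre of a parallel frame, traces may be differentiated termwise. -/
theorem mvfderiv_trace {B : Fin (Module.finrank ℝ E) → Fin (Module.finrank ℝ E) → M → ℝ}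
    (hB : ∀ i j, CMDiffAt ∞ (B i j) x) :
    d% (fun y ↦ ∑ i, ∑ j, (gram g F.field y)⁻¹ i j * B i j y) x = ∑ i, d% (B i i) x := by
  have hGi := contMDiffAt_gram_inv F.smoothAt F.gram_det_ne_zero
  have hm (i j) : CMDiffAt ∞ (fun y ↦ (gram g F.field y)⁻¹ i j * B i j y) x :=
    (hGi i j).mul (hB i j)
  rw [mvfderiv_sum fun i ↦ contMDiffAt_finsetSum fun j _ ↦ hm i j]
  refine Finset.sum_congr rfl fun i _ ↦ ?_
  rw [mvfderiv_sum fun j ↦ hm i j]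
  have hterm (j) : d% (fun y ↦ (gram g F.field y)⁻¹ i j * B i j y) x
      = (if i = j then 1 else 0 : ℝ) • d% (B i j) x := by
    rw [mvfderiv_fun_mul ((hGi i j).mdifferentiableAt (by simp))
      ((hB i j).mdifferentiableAt (by simp)), F.mvfderiv_gram_inv, F.gram_eq_one,
      inv_one, Matrix.one_apply, smul_zero, add_zero]
  simp [hterm]

end ParallelFrame

end Parallel

/-! ### The Ricci tensor -/

/-- A tensorial operation as a linear map on the tangent space. -/
def SmoothTensorialAt.toLinearMap {A : Type*} [AddCommGroup A] [Module ℝ A] {Φ : VField I M → A}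
    {x : M} (hΦ : SmoothTensorialAt I Φ x) : TangentSpace I x →ₗ[ℝ] A where
  toFun u := Φ (extend E u)
  map_add' u v := by
    rw [← hΦ.add (contMDiffAt_extend ..) (contMDiffAt_extend ..)]
    exact hΦ.pointwise (contMDiffAt_extend ..)
      (contMDiffAt_add (contMDiffAt_extend ..) (contMDiffAt_extend ..)) (by simp)
  map_smul' c u := by
    have h := hΦ.smul (f := fun _ ↦ c) contMDiffAt_const (contMDiffAt_extend (k := ∞) I E u)
    rw [RingHom.id_apply, ← h]
    exact hΦ.pointwise (contMDiffAt_extend ..)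
      (contMDiffAt_smul contMDiffAt_const (contMDiffAt_extend ..)) (by simp)

section Ricci

variable {g : Metric I M} {x : M}

theorem curvature_eq_extend (u v w : TangentSpace I x) :
    curvature g x u v w = fieldCurvature g (extend E u) (extend E v) (extend E w) x := by
  rw [← curvature_eq (contMDiffAt_extend ..) (contMDiffAt_extend ..) (contMDiffAt_extend ..)]
  simp

variable (g) in
/-- `u ↦ R(u, v)w` as a linear map. -/
def curvatureLeft (v w : TangentSpace I x) : TangentSpace I x →ₗ[ℝ] TangentSpace I x :=
  (fieldCurvature_tensorial_left (g := g) (V := extend E v)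
    (contMDiffAt_extend I E w)).toLinearMap

theorem curvatureLeft_apply (u v w : TangentSpace I x) :
    curvatureLeft g v w u = curvature g x u v w :=
  (curvature_eq_extend u v w).symm

variable (g) in
/-- `v ↦ R(u, v)w` as a linear map. -/
def curvatureMiddle (u w : TangentSpace I x) : TangentSpace I x →ₗ[ℝ] TangentSpace I x :=
  (fieldCurvature_tensorial_middle (g := g) (U := extend E u)
    (contMDiffAt_extend I E w)).toLinearMap

theorem curvatureMiddle_apply (u v w : TangentSpace I x) :
    curvatureMiddle g u w v = curvature g x u v w :=
  (curvature_eq_extend u v w).symm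

variable (g) in
/-- `w ↦ R(u, v)w` as a linear map. -/
def curvatureRight (u v : TangentSpace I x) : TangentSpace I x →ₗ[ℝ] TangentSpace I x :=
  (fieldCurvature_tensorial_right (g := g) (contMDiffAt_extend I E u)
    (contMDiffAt_extend I E v)).toLinearMap

theorem curvatureRight_apply (u v w : TangentSpace I x) :
    curvatureRight g u v w = curvature g x u v w :=
  (curvature_eq_extend u v w).symm

variable (g x) in
/-- The Ricci tensor as a bilinear map. -/
def ricciBilin : TangentSpace I x →ₗ[ℝ] TangentSpace I x →ₗ[ℝ] ℝ :=
  LinearMap.mk₂ ℝ (ricci g x)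
    (fun v v' w ↦ by
      simp only [ricci, ← curvatureMiddle_apply, map_add, _root_.add_apply, Finset.sum_add_distrib])
    (fun c v w ↦ by
      simp only [ricci, ← curvatureMiddle_apply, map_smul, _root_.smul_apply, Finset.smul_sum])
    (fun v w w' ↦ by
      simp only [ricci, ← curvatureRight_apply, map_add, _root_.add_apply, Finset.sum_add_distrib])
    (fun c v w ↦ by
      simp only [ricci, ← curvatureRight_apply, map_smul, _root_.smul_apply, Finset.smul_sum])

theorem ricci_eq_frame {F : Fin (Module.finrank ℝ E) → VField I M} {V W : VField I M}
    (hF : ∀ i, CMDiffAt ∞ (T% (F i)) x) (hx : (gram g F x).det ≠ 0) (hV : CMDiffAt ∞ (T% V) x)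
    (hW : CMDiffAt ∞ (T% W) x) :
    ricci g x (V x) (W x)
      = ∑ i, ∑ j, (gram g F x)⁻¹ i j * g.inner x (fieldCurvature g (F i) V W x) (F j x) := by
  have h := sum_onb_eq_frame hx (LinearMap.mk₂ ℝ
    (fun u u' ↦ g.inner x (curvatureLeft g (V x) (W x) u) u')
    (by simp) (by simp) (by simp) (by simp))
  simpa [ricci, curvatureLeft_apply, curvature_eq (hF _) hV hW] using h

theorem scal_eq_frame {F : Fin (Module.finrank ℝ E) → VField I M} (hx : (gram g F x).det ≠ 0) :
    scal g x = ∑ i, ∑ j, (gram g F x)⁻¹ i j * ricci g x (F i x) (F j x) :=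
  sum_onb_eq_frame hx (ricciBilin g x)

theorem eventually_ricci_eq_frame (F : ParallelFrame g x) {V W : VField I M}
    (hV : ∀ᶠ y in 𝓝 x, CMDiffAt ∞ (T% V) y) (hW : ∀ᶠ y in 𝓝 x, CMDiffAt ∞ (T% W) y) :
    (fun y ↦ ricci g y (V y) (W y)) =ᶠ[𝓝 x] fun y ↦ ∑ i, ∑ j, (gram g F.field y)⁻¹ i j
      * g.inner y (fieldCurvature g (F.field i) V W y) (F.field j y) := by
  filter_upwards [hV, hW, eventually_all.2 F.smooth,
    eventually_gram_det_ne_zero F.smoothAt F.gram_det_ne_zero] with y h1 h2 h3 h4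
  exact ricci_eq_frame h3 h4 h1 h2

theorem contMDiffAt_ricci_of_eventually {V W : VField I M} (hV : ∀ᶠ y in 𝓝 x, CMDiffAt ∞ (T% V) y)
    (hW : ∀ᶠ y in 𝓝 x, CMDiffAt ∞ (T% W) y) :
    CMDiffAt ∞ (fun y ↦ ricci g y (V y) (W y)) x := by
  obtain ⟨F⟩ := nonempty_parallelFrame g x
  have h : CMDiffAt ∞ (fun y ↦ ∑ i, ∑ j, (gram g F.field y)⁻¹ i j
      * g.inner y (fieldCurvature g (F.field i) V W y) (F.field j y)) x :=
    contMDiffAt_finsetSum fun i _ ↦ contMDiffAt_finsetSum fun j _ ↦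
      (contMDiffAt_gram_inv F.smoothAt F.gram_det_ne_zero i j).mul (contMDiffAt_inner g
        (fieldCurvature_smooth (F.smoothAt i) hV.self_of_nhds hW.self_of_nhds) (F.smoothAt j))
  exact h.congr_of_eventuallyEq (eventually_ricci_eq_frame F hV hW)

/-- Here `V` and `W` are smooth only at `x`, so the frame formula for `ricci` is not available for
them at nearby points. Bilinearity reduces the claim to the frame fields, which are smooth nearby.
-/
theorem contMDiffAt_ricci {V W : VField I M} (hV : CMDiffAt ∞ (T% V) x)
    (hW : CMDiffAt ∞ (T% W) x) : CMDiffAt ∞ (fun y ↦ ricci g y (V y) (W y)) x := by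
  obtain ⟨F⟩ := nonempty_parallelFrame g x
  let c (Z : VField I M) (i : Fin (Module.finrank ℝ E)) (y : M) : ℝ :=
    ∑ j, (gram g F.field y)⁻¹ i j * g.inner y (Z y) (F.field j y)
  have hc {Z : VField I M} (hZ : CMDiffAt ∞ (T% Z) x) (i) : CMDiffAt ∞ (c Z i) x :=
    contMDiffAt_finsetSum fun j _ ↦
      (contMDiffAt_gram_inv F.smoothAt F.gram_det_ne_zero i j).mul
        (contMDiffAt_inner g hZ (F.smoothAt j))
  have h : CMDiffAt ∞ (fun y ↦ ∑ i, ∑ j, c V i y * (c W j y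
      * ricci g y (F.field i y) (F.field j y))) x :=
    contMDiffAt_finsetSum fun i _ ↦ contMDiffAt_finsetSum fun j _ ↦ (hc hV i).mul
      ((hc hW j).mul (contMDiffAt_ricci_of_eventually (F.smooth i) (F.smooth j)))
  refine h.congr_of_eventuallyEq ?_
  filter_upwards [eventually_gram_det_ne_zero F.smoothAt F.gram_det_ne_zero] with y hy
  have hexp (Z : VField I M) : Z y = ∑ i, c Z i y • F.field i y := frame_expansion hy (Z y)
  change ricciBilin g y (V y) (W y) = ∑ i, ∑ j, c V i y * (c W j y
    * ricciBilin g y (F.field i y) (F.field j y))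
  conv_lhs => rw [hexp V, hexp W]
  simp only [map_sum, map_smul, LinearMap.sum_apply, LinearMap.smul_apply, smul_eq_mul,
    Finset.mul_sum]
  rw [Finset.sum_comm]
  exact Finset.sum_congr rfl fun i _ ↦ Finset.sum_congr rfl fun j _ ↦ mul_left_comm ..

theorem eventually_scal_eq_frame (F : ParallelFrame g x) :
    scal g =ᶠ[𝓝 x] fun y ↦ ∑ i, ∑ j, (gram g F.field y)⁻¹ i j
      * ricci g y (F.field i y) (F.field j y) := by
  filter_upwards [eventually_gram_det_ne_zero F.smoothAt F.gram_det_ne_zero] with y hy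
  exact scal_eq_frame hy

theorem contMDiff_scal (g : Metric I M) : CMDiff ∞ (scal g) := by
  intro x
  obtain ⟨F⟩ := nonempty_parallelFrame g x
  have h : CMDiffAt ∞ (fun y ↦ ∑ i, ∑ j, (gram g F.field y)⁻¹ i j
      * ricci g y (F.field i y) (F.field j y)) x :=
    contMDiffAt_finsetSum fun i _ ↦ contMDiffAt_finsetSum fun j _ ↦
      (contMDiffAt_gram_inv F.smoothAt F.gram_det_ne_zero i j).mul
        (contMDiffAt_ricci_of_eventually (F.smooth i) (F.smooth j))
  exact h.congr_of_eventuallyEq (eventually_scal_eq_frame F)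

theorem mvfderiv_ricci (F : ParallelFrame g x) {V W : VField I M}
    (hV : ∀ᶠ y in 𝓝 x, CMDiffAt ∞ (T% V) y) (hW : ∀ᶠ y in 𝓝 x, CMDiffAt ∞ (T% W) y) :
    d% (fun y ↦ ricci g y (V y) (W y)) x
      = ∑ i, d% (fun y ↦ g.inner y (fieldCurvature g (F.field i) V W y) (F.field i y)) x := by
  rw [mvfderiv_congr (eventually_ricci_eq_frame F hV hW)]
  exact F.mvfderiv_trace (B := fun i j y ↦
    g.inner y (fieldCurvature g (F.field i) V W y) (F.field j y)) fun i j ↦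
      contMDiffAt_inner g (fieldCurvature_smooth (F.smoothAt i) hV.self_of_nhds hW.self_of_nhds)
        (F.smoothAt j)

theorem mvfderiv_scal (F : ParallelFrame g x) :
    d% (scal g) x = ∑ j, d% (fun y ↦ ricci g y (F.field j y) (F.field j y)) x := by
  rw [mvfderiv_congr (eventually_scal_eq_frame F)]
  exact F.mvfderiv_trace (B := fun i j y ↦ ricci g y (F.field i y) (F.field j y)) fun i j ↦
    contMDiffAt_ricci_of_eventually (F.smooth i) (F.smooth j)

theorem mvfderiv_inner_of_parallel {U W Z : VField I M} (hU : CMDiffAt ∞ (T% U) x)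
    (hW : CMDiffAt ∞ (T% W) x) (hZ : CMDiffAt ∞ (T% Z) x) (hZ0 : leviCivita g Z x = 0) :
    d% (fun y ↦ g.inner y (W y) (Z y)) x (U x) = g.inner x (cov g U W x) (Z x) := by
  rw [leviCivita_metric g (mdiffAt_of_smooth hU) (mdiffAt_of_smooth hW) (mdiffAt_of_smooth hZ),
    hZ0]
  simp [cov]

/-- The contracted second Bianchi identity `d scal = 2 div S`. -/
theorem contracted_bianchi (F : ParallelFrame g x) {V : VField I M}
    (hV : ∀ᶠ y in 𝓝 x, CMDiffAt ∞ (T% V) y) (hV0 : leviCivita g V x = 0) :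
    d% (scal g) x (V x)
      = 2 * ∑ i, d% (fun y ↦ ricci g y (V y) (F.field i y)) x (onb g x i) := by
  have hVx := hV.self_of_nhds
  have hF := F.smoothAt
  have hK {A B C : VField I M} (hA : CMDiffAt ∞ (T% A) x) (hB : CMDiffAt ∞ (T% B) x)
      (hC : CMDiffAt ∞ (T% C) x) := fieldCurvature_smooth (g := g) hA hB hC
  have bianchi (a j) :
      d% (fun y ↦ g.inner y (fieldCurvature g (F.field a) (F.field j) (F.field j) y)
        (F.field a y)) x (V x)
      = d% (fun y ↦ g.inner y (fieldCurvature g (F.field j) V (F.field a) y)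
        (F.field j y)) x (onb g x a)
      + d% (fun y ↦ g.inner y (fieldCurvature g (F.field a) V (F.field j) y)
        (F.field a y)) x (onb g x j) := by
    -- The second Bianchi identity for `V, E_a, E_j` acting on `E_j`, paired with `E_a`.
    have h := congrArg (fun v ↦ g.inner x v (F.field a x)) (second_bianchi hVx (hF a) (hF j) (hF j)
      hV0 (F.parallel a) (F.parallel j) (F.parallel j))
    simp only [map_add, _root_.add_apply, map_zero, _root_.zero_apply] at h
    -- Since `E_a` is parallel at `x`, each pairing is the derivative of a scalar function.
    rw [← mvfderiv_inner_of_parallel hVx (hK (hF a) (hF j) (hF j)) (hF a) (F.parallel a),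
      ← mvfderiv_inner_of_parallel (hF a) (hK (hF j) hVx (hF j)) (hF a) (F.parallel a),
      ← mvfderiv_inner_of_parallel (hF j) (hK hVx (hF a) (hF j)) (hF a) (F.parallel a)] at h
    -- Skew-adjointness moves `E_j` into the traced slot; the third term needs only antisymmetry in
    -- the first two arguments.
    have h2 : (fun y ↦ g.inner y (fieldCurvature g (F.field j) V (F.field j) y) (F.field a y))
        =ᶠ[𝓝 x] fun y ↦ -g.inner y (fieldCurvature g (F.field j) V (F.field a) y)
          (F.field j y) := by
      filter_upwards [F.smooth j, F.smooth a, hV] with y hj ha hv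
      exact inner_fieldCurvature_skew hj hv hj ha
    have h3 : (fun y ↦ g.inner y (fieldCurvature g V (F.field a) (F.field j) y) (F.field a y))
        = fun y ↦ -g.inner y (fieldCurvature g (F.field a) V (F.field j) y) (F.field a y) := by
      funext y
      rw [fieldCurvature_swap, map_neg, _root_.neg_apply]
    rw [mvfderiv_congr h2, h3, mvfderiv_fun_neg, mvfderiv_fun_neg, _root_.neg_apply,
      _root_.neg_apply, F.apply, F.apply] at h
    linarith
  simp only [mvfderiv_scal F, mvfderiv_ricci F (F.smooth _) (F.smooth _),
    mvfderiv_ricci F hV (F.smooth _), _root_.sum_apply, bianchi, Finset.sum_add_distrib]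
  -- Both double sums are the divergence of `S`; the first is traced over the outer index and has to
  -- be reordered.
  rw [Finset.sum_comm, two_mul]

end Ricci

/-! ### The divergence of `L_ξ g` for an `η`-Ricci soliton -/

section Soliton

variable {g : Metric I M} {x : M}

theorem sharp_flat (g : Metric I M) (X : VField I M) : sharp g (flat g X) = X := by
  funext x
  exact onb_expansion g (X x)

theorem lieMetric_apply {X U V : VField I M} (hU : CMDiffAt ∞ (T% U) x)
    (hV : CMDiffAt ∞ (T% V) x) :
    lieMetric g X x (U x) (V x) = d% (fun y ↦ g.inner y (U y) (V y)) x (X x)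
      - g.inner x (mlieBracket I X U x) (V x) - g.inner x (U x) (mlieBracket I X V x) :=
  TensorialAt.mkHom₂_apply _ _ (mdiffAt_of_smooth hU) (mdiffAt_of_smooth hV)

theorem lieMetric_symm (X : VField I M) (u v : TangentSpace I x) :
    lieMetric g X x u v = lieMetric g X x v u := by
  have hu : CMDiffAt ∞ (T% (extend E u : VField I M)) x := contMDiffAt_extend ..
  have hv : CMDiffAt ∞ (T% (extend E v : VField I M)) x := contMDiffAt_extend ..
  have h1 := lieMetric_apply (g := g) (X := X) hu hv
  have h2 := lieMetric_apply (g := g) (X := X) hv hu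
  simp only [extend_apply_self] at h1 h2
  rw [h1, h2, d_symm, g.symm x _ v, g.symm x _ u]
  ring

/-- `nablaTensor` may be computed with any smooth extensions. -/
theorem nablaTensor_apply {T : Tensor2 I M} {U V : VField I M}
    (hT : ∀ U V : VField I M, CMDiffAt ∞ (T% U) x → CMDiffAt ∞ (T% V) x →
      MDiffAt (fun y ↦ T y (U y) (V y)) x)
    (w : TangentSpace I x) (hU : CMDiffAt ∞ (T% U) x) (hV : CMDiffAt ∞ (T% V) x) :
    nablaTensor g T x w (U x) (V x) = d% (fun y ↦ T y (U y) (V y)) x w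
      - T x (leviCivita g U x w) (V x) - T x (U x) (leviCivita g V x w) := by
  let Φ (U V : VField I M) : ℝ := d% (fun y ↦ T y (U y) (V y)) x w
      - T x (leviCivita g U x w) (V x) - T x (U x) (leviCivita g V x w)
  have hleft {V : VField I M} (hV : CMDiffAt ∞ (T% V) x) : SmoothTensorialAt I (Φ · V) x := by
    constructor
    · intro f U hf hU
      have hf' : MDiffAt f x := hf.mdifferentiableAt (by simp)
      have h : (fun y ↦ T y ((f • U) y) (V y)) = fun y ↦ f y * T y (U y) (V y) := by
        funext y
        simp
      simp only [Φ, h, mvfderiv_fun_mul hf' (hT U V hU hV), leviCivita_smul hf'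
        (mdiffAt_of_smooth hU)]
      simp
      ring
    · intro U U' hU hU'
      have h : (fun y ↦ T y ((U + U') y) (V y))
          = fun y ↦ T y (U y) (V y) + T y (U' y) (V y) := by
        funext y
        simp
      simp only [Φ, h, mvfderiv_fun_add (hT U V hU hV) (hT U' V hU' hV), leviCivita_add
        (mdiffAt_of_smooth hU) (mdiffAt_of_smooth hU')]
      simp
      ring
  have hright {U : VField I M} (hU : CMDiffAt ∞ (T% U) x) : SmoothTensorialAt I (Φ U) x := by
    constructor
    · intro f V hf hV
      have hf' : MDiffAt f x := hf.mdifferentiableAt (by simp)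
      have h : (fun y ↦ T y (U y) ((f • V) y)) = fun y ↦ f y * T y (U y) (V y) := by
        funext y
        simp
      simp only [Φ, h, mvfderiv_fun_mul hf' (hT U V hU hV), leviCivita_smul hf'
        (mdiffAt_of_smooth hV)]
      simp
      ring
    · intro V V' hV hV'
      have h : (fun y ↦ T y (U y) ((V + V') y))
          = fun y ↦ T y (U y) (V y) + T y (U y) (V' y) := by
        funext y
        simp
      simp only [Φ, h, mvfderiv_fun_add (hT U V hU hV) (hT U V' hU hV'), leviCivita_add
        (mdiffAt_of_smooth hV) (mdiffAt_of_smooth hV')]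
      simp
      ring
  have hu : CMDiffAt ∞ (T% (extend E (U x) : VField I M)) x := contMDiffAt_extend ..
  have hv : CMDiffAt ∞ (T% (extend E (V x) : VField I M)) x := contMDiffAt_extend ..
  have h : Φ (extend E (U x)) (extend E (V x)) = Φ U V := by
    rw [(hleft hv).pointwise hu hU (extend_apply_self ..),
      (hright hU).pointwise hv hV (extend_apply_self ..)]
  simp only [Φ, extend_apply_self] at h
  exact h

/-- `nablaForm` of the dual form of `ξ` is dual to the derivative of `ξ`. -/
theorem nablaForm_flat {ξ : VField I M} (hξ : CMDiffAt ∞ (T% ξ) x) (w v : TangentSpace I x) :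
    nablaForm g (flat g ξ) x w v = g.inner x (leviCivita g ξ x w) v := by
  have h := leviCivita_metric g (X := extend E w) (Y := ξ) (Z := extend E v)
    (mdiffAt_of_smooth (contMDiffAt_extend ..)) (mdiffAt_of_smooth hξ)
    (mdiffAt_of_smooth (contMDiffAt_extend ..))
  simp only [extend_apply_self] at h
  simp only [nablaForm, flat]
  rw [h]
  ring

/-- `(L_ξ g)(u, u) = 2 g(∇_u ξ, u)`. -/
theorem lieMetric_self {ξ : VField I M} (hξ : CMDiffAt ∞ (T% ξ) x) (u : TangentSpace I x) :
    lieMetric g ξ x u u = 2 * g.inner x (leviCivita g ξ x u) u := by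
  have hu : CMDiffAt ∞ (T% (extend E u : VField I M)) x := contMDiffAt_extend ..
  have h := lieMetric_apply (g := g) (X := ξ) hu hu
  rw [mlieBracket_eq_cov (g := g) (mdiffAt_of_smooth hξ) (mdiffAt_of_smooth hu),
    leviCivita_metric g (mdiffAt_of_smooth hξ) (mdiffAt_of_smooth hu) (mdiffAt_of_smooth hu)] at h
  simp only [cov, extend_apply_self, map_sub, _root_.sub_apply] at h
  rw [h, g.symm x u]
  rw [g.symm x u]
  ring

theorem IsEtaRicciSoliton.lieMetric_eq {ξ : VField I M} {η : OneForm I M} {lam mu : ℝ}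
    (h : IsEtaRicciSoliton g ξ η lam mu) (x : M) (u v : TangentSpace I x) :
    lieMetric g ξ x u v
      = -2 * ricci g x u v + (-2 * lam) * g.inner x u v + (-2 * mu) * (η x u * η x v) := by
  linarith [h x u v]

/-- Every other term of the soliton equation is symmetric, so the pair symmetry of the curvature is
not needed. -/
theorem IsEtaRicciSoliton.ricci_symm {ξ : VField I M} {η : OneForm I M} {lam mu : ℝ}
    (h : IsEtaRicciSoliton g ξ η lam mu) (x : M) (u v : TangentSpace I x) :
    ricci g x u v = ricci g x v u := by
  have h1 := h.lieMetric_eq x u v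
  have h2 := h.lieMetric_eq x v u
  rw [lieMetric_symm, g.symm x u v] at h1
  linarith

theorem sum_inner_onb_mul (g : Metric I M) (A : TangentSpace I x →L[ℝ] ℝ)
    (v : TangentSpace I x) : ∑ i, g.inner x v (onb g x i) * A (onb g x i) = A v := by
  have h := congrArg A (onb_expansion g v)
  simpa using h

/-- The trace of the soliton equation. -/
theorem IsEtaRicciSoliton.trace {ξ : VField I M} {lam mu : ℝ} (hξ : CMDiffAt ∞ (T% ξ) x)
    (h : IsEtaRicciSoliton g ξ (flat g ξ) lam mu) :
    ∑ i, g.inner x (leviCivita g ξ x (onb g x i)) (onb g x i)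
      = -(scal g x + lam * Module.finrank ℝ E + mu * g.inner x (ξ x) (ξ x)) := by
  have h1 (i) : g.inner x (leviCivita g ξ x (onb g x i)) (onb g x i)
      = -(ricci g x (onb g x i) (onb g x i) + lam * 1
        + mu * (g.inner x (ξ x) (onb g x i) * g.inner x (ξ x) (onb g x i))) := by
    have h2 := h.lieMetric_eq x (onb g x i) (onb g x i)
    rw [lieMetric_self hξ, inner_onb, if_pos rfl] at h2
    simp only [flat] at h2
    linarith
  simp only [h1, Finset.sum_neg_distrib, Finset.sum_add_distrib, ← Finset.mul_sum,
    sum_inner_onb_mul g (g.inner x (ξ x)) (ξ x)]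
  simp [scal]

theorem mvfderiv_linear_combination {a b c : ℝ} {p q r s : M → ℝ} (hp : MDiffAt p x)
    (hq : MDiffAt q x) (hr : MDiffAt r x) (hs : MDiffAt s x) :
    d% (fun y ↦ a * p y + b * q y + c * (r y * s y)) x
      = a • d% p x + b • d% q x + c • (r x • d% s x + s x • d% r x) := by
  have hconst (t : ℝ) : MDiffAt (fun _ : M ↦ t) x := mdifferentiableAt_const
  have hmul (t : ℝ) {f : M → ℝ} (hf : MDiffAt f x) : MDiffAt (fun y ↦ t * f y) x :=
    (hconst t).mul hf
  have hdmul (t : ℝ) {f : M → ℝ} (hf : MDiffAt f x) : d% (fun y ↦ t * f y) x = t • d% f x := by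
    rw [mvfderiv_fun_mul (hconst t) hf, mvfderiv_const, smul_zero, add_zero]
  have hrs : MDiffAt (fun y ↦ r y * s y) x := hr.mul hs
  have hpq : MDiffAt (fun y ↦ a * p y + b * q y) x := (hmul a hp).add (hmul b hq)
  rw [mvfderiv_fun_add hpq (hmul c hrs), mvfderiv_fun_add (hmul a hp) (hmul b hq), hdmul a hp,
    hdmul b hq, hdmul c hrs, mvfderiv_fun_mul hr hs]

/-- The divergence of `L_ξ g` for an `η`-Ricci soliton. -/
theorem IsEtaRicciSoliton.divTensor_lieMetric {ξ : VField I M} {lam mu : ℝ}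
    (hξ : CMDiff ∞ (T% ξ)) (h : IsEtaRicciSoliton g ξ (flat g ξ) lam mu)
    (v : TangentSpace I x) :
    divTensor g (lieMetric g ξ) x v = -d% (scal g) x v
      + 2 * mu * ((scal g x + lam * Module.finrank ℝ E + mu * g.inner x (ξ x) (ξ x))
        * flat g ξ x v - nablaForm g (flat g ξ) x (ξ x) v) := by
  obtain ⟨F⟩ := nonempty_parallelFrame g x
  obtain ⟨V, hV, rfl, hV0⟩ := exists_parallel_extension g v
  have hVx := hV.self_of_nhds
  have hη {U : VField I M} (hU : CMDiffAt ∞ (T% U) x) :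
      MDiffAt (fun y ↦ g.inner y (ξ y) (U y)) x :=
    mdifferentiableAt_inner g (mdiffAt_of_smooth (hξ x)) (mdiffAt_of_smooth hU)
  have hS {U V : VField I M} (hU : CMDiffAt ∞ (T% U) x) (hV : CMDiffAt ∞ (T% V) x) :
      MDiffAt (fun y ↦ ricci g y (U y) (V y)) x :=
    (contMDiffAt_ricci hU hV).mdifferentiableAt (by simp)
  have hfun (U V : VField I M) : (fun y ↦ lieMetric g ξ y (U y) (V y))
      = fun y ↦ -2 * ricci g y (U y) (V y) + (-2 * lam) * g.inner y (U y) (V y)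
        + (-2 * mu) * (g.inner y (ξ y) (U y) * g.inner y (ξ y) (V y)) :=
    funext fun y ↦ h.lieMetric_eq y (U y) (V y)
  have hg {U V : VField I M} (hU : CMDiffAt ∞ (T% U) x) (hV : CMDiffAt ∞ (T% V) x) :=
    mdifferentiableAt_inner g (mdiffAt_of_smooth hU) (mdiffAt_of_smooth hV)
  have hT (U V : VField I M) (hU : CMDiffAt ∞ (T% U) x) (hV : CMDiffAt ∞ (T% V) x) :
      MDiffAt (fun y ↦ lieMetric g ξ y (U y) (V y)) x := by
    rw [hfun]
    exact (((hS hU hV).const_smul (-2 : ℝ)).add ((hg hU hV).const_smul (-2 * lam))).add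
      (((hη hU).mul (hη hV)).const_smul (-2 * mu))
  have hform {U : VField I M} (hU : CMDiffAt ∞ (T% U) x) (hU0 : leviCivita g U x = 0)
      (w : TangentSpace I x) :
      d% (fun y ↦ g.inner y (ξ y) (U y)) x w = g.inner x (leviCivita g ξ x w) (U x) := by
    have hw := leviCivita_metric g (X := extend E w) (mdiffAt_of_smooth (contMDiffAt_extend ..))
      (mdiffAt_of_smooth (hξ x)) (mdiffAt_of_smooth hU)
    rw [hU0, extend_apply_self] at hw
    simpa using hw
  -- With `E_i` and `V` parallel at `x` the correction terms vanish, the metric term has zero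
  -- derivative, and the Leibniz rule for `η(E_i) η(V)` gives the two products.
  have hterm (i) : nablaTensor g (lieMetric g ξ) x (onb g x i) (onb g x i) (V x)
      = -2 * d% (fun y ↦ ricci g y (V y) (F.field i y)) x (onb g x i)
        + (-2 * mu) * (g.inner x (ξ x) (onb g x i)
            * g.inner x (leviCivita g ξ x (onb g x i)) (V x)
          + g.inner x (ξ x) (V x)
            * g.inner x (leviCivita g ξ x (onb g x i)) (onb g x i)) := by
    have hFi := F.smoothAt i
    have h0 := nablaTensor_apply (g := g) hT (onb g x i) hFi hVx
    rw [F.parallel, hV0, hfun, mvfderiv_linear_combination (hS hFi hVx) (hg hFi hVx) (hη hFi)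
      (hη hVx), mvfderiv_inner_eq_zero hFi hVx (F.parallel i) hV0] at h0
    simp only [F.apply] at h0
    have hsymm : (fun y ↦ ricci g y (F.field i y) (V y)) = fun y ↦ ricci g y (V y) (F.field i y) :=
      funext fun y ↦ h.ricci_symm y _ _
    simp only [hsymm, _root_.add_apply, _root_.smul_apply, smul_eq_mul, hform hFi (F.parallel i),
      hform hVx hV0, F.apply] at h0
    rw [h0]
    simp
  -- Expanding `ξ` in the orthonormal basis turns this sum into `(∇_ξ η)(V)`; the other sum is `η(V)
  -- div ξ`, handled by the traced soliton equation.
  have hdual : ∑ i, g.inner x (ξ x) (onb g x i) * g.inner x (leviCivita g ξ x (onb g x i)) (V x)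
      = g.inner x (leviCivita g ξ x (ξ x)) (V x) := by
    simp only [g.symm x _ (V x)]
    exact sum_inner_onb_mul g ((g.inner x (V x)).comp (leviCivita g ξ x)) (ξ x)
  rw [divTensor, nablaForm_flat (hξ x), contracted_bianchi F hV hV0]
  simp only [hterm, Finset.sum_add_distrib, ← Finset.mul_sum, hdual, h.trace (hξ x), flat]
  ring

end Soliton

/-- A function with vanishing differential on a preconnected manifold without boundary is
constant. -/
theorem exists_eq_const_of_mvfderiv_eq_zero [I.Boundaryless] [PreconnectedSpace M] {f : M → ℝ}
    (hf : MDiff f) (hd : ∀ x, d% f x = 0) : ∃ c : ℝ, ∀ x, f x = c := by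
  have hloc : IsLocallyConstant f := by
    rw [IsLocallyConstant.iff_eventually_eq]
    intro x
    let φ := extChartAt I x
    obtain ⟨r, hr, hball⟩ := Metric.isOpen_iff.1 (isOpen_extChartAt_target (I := I) x) (φ x)
      (mem_extChartAt_target x)
    have hderiv : ∀ z ∈ Metric.ball (φ x) r, HasFDerivAt (f ∘ φ.symm) (0 : E →L[ℝ] ℝ) z := by
      intro z hz
      have hs : MDifferentiableAt 𝓘(ℝ, E) I φ.symm z := by
        have h := mdifferentiableWithinAt_extChartAt_symm (I := I) (hball hz)
        -- Without boundary, differentiability within the range of `I` is full differentiability.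
        rwa [I.range_eq_univ, mdifferentiableWithinAt_univ] at h
      have hcomp : MDifferentiableAt 𝓘(ℝ, E) 𝓘(ℝ) (f ∘ φ.symm) z := (hf _).comp z hs
      have h0 : mvfderiv 𝓘(ℝ, E) (f ∘ φ.symm) z = 0 := by
        rw [mvfderiv_comp z (hf _) hs, hd]
        rfl
      have h1 := hcomp.differentiableAt.hasFDerivAt
      have h2 : fderiv ℝ (f ∘ φ.symm) z = 0 := by
        rw [← mfderiv_eq_fderiv]
        exact h0
      rwa [h2] at h1
    have hconst : ∀ z ∈ Metric.ball (φ x) r, (f ∘ φ.symm) z = (f ∘ φ.symm) (φ x) := by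
      intro z hz
      -- A chart ball is convex, so a vanishing derivative makes `f` constant on it.
      exact (convex_ball (φ x) r).is_const_of_fderivWithin_eq_zero (𝕜 := ℝ)
        (fun w hw ↦ (hderiv w hw).differentiableAt.differentiableWithinAt)
        (fun w hw ↦ (hderiv w hw).hasFDerivWithinAt.fderivWithin
          (Metric.isOpen_ball.uniqueDiffWithinAt hw)) hz (Metric.mem_ball_self hr)
    have hmem : ∀ᶠ y in 𝓝 x, φ y ∈ Metric.ball (φ x) r :=
      (continuousAt_extChartAt x).eventually_mem (Metric.ball_mem_nhds _ hr)
    filter_upwards [hmem, extChartAt_source_mem_nhds (I := I) x] with y hy hys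
    have h := hconst _ hy
    rw [Function.comp_apply, Function.comp_apply] at h
    rwa [(extChartAt I x).left_inv hys, extChartAt_to_inv] at h
  -- A preconnected space may be empty, and then any constant serves.
  rcases isEmpty_or_nonempty M with hM | ⟨⟨x₀⟩⟩
  · exact ⟨0, fun x ↦ hM.elim x⟩
  · exact ⟨f x₀, fun x ↦ hloc.apply_eq_of_preconnectedSpace x x₀⟩

end RiemGeom
end

/-! ### The main theorem -/

theorem mainTheorem1 {n : ℕ} {M : Type*} [TopologicalSpace M]
    [ChartedSpace (EuclideanSpace ℝ (Fin n)) M] [IsManifold (𝓡 n) ∞ M]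
    (g : RiemGeom.Metric (𝓡 n) M)
    (ξ : RiemGeom.VField (𝓡 n) M) (hξ : ContMDiff (𝓡 n) (𝓡 n).tangent ∞ (T% ξ))
    (η : RiemGeom.OneForm (𝓡 n) M) (hη : η = RiemGeom.flat g ξ)
    (lam mu : ℝ) (hsol : RiemGeom.IsEtaRicciSoliton g ξ η lam mu) :
    (RiemGeom.IsSchrodingerRicciSolution g η ↔
      ∀ (x : M) (v : TangentSpace (𝓡 n) x),
        mvfderiv (𝓡 n) (RiemGeom.scal g) x v =
          2 * mu * ((RiemGeom.scal g x + lam * n + mu * g.inner x (ξ x) (ξ x)) * η x v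
            - RiemGeom.nablaForm g η x (ξ x) v)) ∧
    (PreconnectedSpace M → RiemGeom.IsSchrodingerRicciSolution g η →
      ((∃ c : ℝ, ∀ x : M, RiemGeom.scal g x = c) ↔
        (mu = 0 ∨ ∀ (x : M) (v : TangentSpace (𝓡 n) x),
          (RiemGeom.scal g x + lam * n + mu * g.inner x (ξ x) (ξ x)) * η x v
            = RiemGeom.nablaForm g η x (ξ x) v))) ∧
    (mu = 0 → RiemGeom.IsRicciSoliton g ξ lam) := by
  have : FiniteDimensional ℝ (EuclideanSpace ℝ (Fin n)) := inferInstance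
  subst hη
  have hdiv (x : M) (v : TangentSpace (𝓡 n) x) := hsol.divTensor_lieMetric hξ v
  simp only [finrank_euclideanSpace, Fintype.card_fin] at hdiv
  have hiff : RiemGeom.IsSchrodingerRicciSolution g (RiemGeom.flat g ξ) ↔
      ∀ (x : M) (v : TangentSpace (𝓡 n) x),
        mvfderiv (𝓡 n) (RiemGeom.scal g) x v =
          2 * mu * ((RiemGeom.scal g x + lam * n + mu * g.inner x (ξ x) (ξ x))
            * RiemGeom.flat g ξ x v
            - RiemGeom.nablaForm g (RiemGeom.flat g ξ) x (ξ x) v) := by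
    rw [RiemGeom.IsSchrodingerRicciSolution, RiemGeom.sharp_flat]
    refine forall₂_congr fun x v ↦ ?_
    rw [hdiv, neg_add_eq_zero]
  refine ⟨hiff, fun hM hS ↦ ⟨?_, fun h ↦ ?_⟩, ?_⟩
  · rintro ⟨c, hc⟩
    refine or_iff_not_imp_left.2 fun hmu x v ↦ ?_
    have h := hiff.1 hS x v
    -- Replace `scal` by the constant to make its differential vanish, then restore it on the other
    -- side.
    rw [funext hc, mvfderiv_const, ← funext hc] at h
    have h2 : 2 * mu ≠ 0 := mul_ne_zero two_ne_zero hmu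
    exact sub_eq_zero.1 ((mul_eq_zero.1 h.symm).resolve_left h2)
  · refine RiemGeom.exists_eq_const_of_mvfderiv_eq_zero
      ((RiemGeom.contMDiff_scal g).mdifferentiable (by simp)) fun x ↦ ?_
    ext v
    rw [hiff.1 hS x v]
    rcases h with rfl | h
    · simp
    · simp [h x v]
  · rintro rfl x u v
    simpa using hsol x u v
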